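/- **Theorem (Lieb–Robinson bounds for multi-commutators, Part I).** *Setting.* Let $d\in\mathbb N$, $\mathfrak L=\mathbb Z^d$ with Euclidean length $|\cdot|$, and $\Lambda_L=\{x\in\mathfrak L:|x_1|,\dots,|x_d|\le L\}$ for $L\ge 0$. Let $\mathcal U$ be the CAR $C^*$-algebra of $\mathfrak L$, generated by a unit and $\{a_x\}_{x\in\mathfrak L}$ with $a_xa_y+a_ya_x=0$, $a_xa_y^*+a_y^*a_x=\delta_{x,y}\mathbf 1$; for finite $\Lambda\subset\mathfrak L$ let $\mathcal U_\Lambda\subset\mathcal U$ be the $*$-subalgebra generated by $\mathbf 1$ and $\{a_x\}_{x\in\Lambda}$. Let $\chi_x$ be the $*$-automorphism of $\mathcal U$ with $\chi_x(a_y)=a_{x+y}$ and call $B\in\mathcal U$ even if it is fixed by the $*$-automorphism sending each $a_x$ to $-a_x$. Let $\mathbf F:[0,\infty)\to(0,\infty)$ be non-increasing with $\sum_{x\in\mathfrak L}\mathbf F(|x|)<\infty$ and $$\mathbf D=\sup_{x,y\in\mathfrak L}\sum_{z\in\mathfrak L}\frac{\mathbf F(|x-z|)\mathbf F(|z-y|)}{\mathbf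 F(|x-y|)}<\infty .$$ Let $\Psi=\{\Psi_\Lambda\}$, indexed by the finite subsets $\Lambda$ of $\mathfrak L$, be an interaction, i.e. $\Psi_\Lambda=\Psi_\Lambda^*\in\mathcal U_\Lambda$ is even and $\Psi_\emptyset=0$, with $$\|\Psi\|_{\mathcal W}=\sup_{x,y\in\mathfrak L}\ \sum_{\Lambda\supseteq\{x,y\}}\frac{\|\Psi_\Lambda\|}{\mathbf F(|x-y|)}<\infty ,$$ and let $\mathbf V=\{\mathbf V_{\{x\}}\}_{x\in\mathfrak L}$ be any potential, i.e. $\mathbf V_{\{x\}}=\mathbf V_{\{x\}}^*\in\mathcal U_{\{x\}}$ is even (no bound uniform in $x$ is assumed). Put $H_L=\sum_{\Lambda\subseteq\Lambda_L}\Psi_\Lambda+\sum_{x\in\Lambda_L}\mathbf V_{\{x\}}$ and $\tau^{(L)}_t(B)=e^{itH_L}Be^{-itH_L}$. *Trees.* $\mathcal T_2=\{\{\{0,1\}\}\}$ and $\mathcal T_{k+1}=\{\{\{j,k\}\}\cup T: 0\le j\le k-1,\ T\in\mathcal T_k\}$ for $k\ge2$. For $T\in\mathcal T_{k+1}$ and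 $1\le j\le k$, $\mathrm P_T(j)$ is the unique $i<j$ with $\{i,j\}\in T$, and $$\varkappa_T(\{(n_j,x_j)\}_{j=0}^k)=\prod_{j=1}^k\mathbf 1\big[(\Lambda_{n_j}+x_j)\cap(\Lambda_{n_{\mathrm P_T(j)}}+x_{\mathrm P_T(j)})\ne\emptyset\big].$$ $\mathcal S_{\ell,k}$ is the set of strictly increasing maps $\pi:\{\ell,\dots,k\}\to\{1,\dots,k\}$. Multi-commutators are $[B_1,B_0]^{(2)}=B_1B_0-B_0B_1$ and $[B_k,\dots,B_0]^{(k+1)}=[B_k,[B_{k-1},\dots,B_0]^{(k)}]$. *Claim.* For all $t\in\mathbb R$ and $B\in\mathcal U$ the limit $\tau_t(B)=\lim_{L\to\infty}\tau_t^{(L)}(B)$ exists in norm. Moreover, for every integer $k\ge1$, all $m_0,\dots,m_k\in\mathbb N_0$, $s_1,\dots,s_k\in\mathbb R$, $x_0,\dots,x_k\in\mathfrak L$, and all $B_j\in\mathcal U_{\Lambda_{m_j}}$ $(0\le j\le k)$ with $B_1,\dots,B_k$ even, $$\Big\|\big[\tau_{s_k}\chi_{x_k}(B_k),\dots,\tau_{s_1}\chi_{x_1}(B_1),\chi_{x_0}(B_0)\big]^{(k+1)}\Big\|\le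 2^k\prod_{j=0}^k\|B_j\|\sum_{T\in\mathcal T_{k+1}}\Big(\varkappa_T(\{(m_j,x_j)\}_{j=0}^k)+\Re_{T,\|\Psi\|_{\mathcal W}}\Big),$$ where, for $\alpha\ge0$, $$\Re_{T,\alpha}=\sum_{\ell=1}^k(2\alpha)^{k-\ell+1}\sum_{\pi\in\mathcal S_{\ell,k}}\Big(\prod_{j\in J_\pi}|s_j|e^{4\mathbf D\alpha|s_j|}\Big)\sum_{(n_j)_{j\in J_\pi}}\ \sum_{(z_j)_{j\in J_\pi}}\ \sum_{(y_j)_{j\in J_\pi}}\varkappa_T(\{(n_j,x_j)\}_{j=0}^k)\prod_{j\in J_\pi}\mathbf F(|z_j-y_j|),$$ with $J_\pi=\{\pi(\ell),\dots,\pi(k)\}$, the sums running over all integers $n_j\ge m_j+1$, all $z_j\in\Lambda_{m_j}$ and all $y_j\in\Lambda_{n_j}\setminus\Lambda_{n_j-1}$ $(j\in J_\pi)$, and $n_j=m_j$ for $j\in\{0,\dots,k\}\setminus J_\pi$. -/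

import Mathlib

open Filter Topology

noncomputable section

namespace MultiLR

section WeightedShift

variable {ι : Type*}

theorem weightedShift_sum_le (f : ι → ι) (w : ι → ℂ) (hw : ∀ i, ‖w i‖ ≤ 1)
    (hf : Set.InjOn f {i | w i ≠ 0}) (ψ : lp (fun _ : ι => ℂ) 2) (s : Finset ι) :
    ∑ i ∈ s, ‖w i * ψ (f i)‖ ^ (2 : ENNReal).toReal ≤ ‖ψ‖ ^ (2 : ENNReal).toReal := by
  classical
  have h2 : 0 < (2 : ENNReal).toReal := by norm_num
  have h1 : ∑ i ∈ s, ‖w i * ψ (f i)‖ ^ (2 : ENNReal).toReal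
      ≤ ∑ i ∈ s with w i ≠ 0, ‖ψ (f i)‖ ^ (2 : ENNReal).toReal := by
    rw [Finset.sum_filter]
    refine Finset.sum_le_sum fun i _ => ?_
    split_ifs with h
    · refine Real.rpow_le_rpow (norm_nonneg _) ?_ h2.le
      rw [norm_mul]
      exact mul_le_of_le_one_left (norm_nonneg _) (hw i)
    · have h0 : w i = 0 := not_not.mp h
      simp [h0]
  refine h1.trans ?_
  have hinj : Set.InjOn f ((s.filter fun i => w i ≠ 0 : Finset ι) : Set ι) :=
    hf.mono fun i hi => by simpa using (Finset.mem_filter.mp hi).2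
  rw [← Finset.sum_image (f := fun j => ‖ψ j‖ ^ (2 : ENNReal).toReal) hinj]
  exact lp.sum_rpow_le_norm_rpow h2 ψ _

/-- The contraction `(T ψ)(i) = w i * ψ (f i)` of `ℓ²(ι)`, where `|w| ≤ 1` and `f` is injective
on the support of `w`. -/
def weightedShift (f : ι → ι) (w : ι → ℂ) (hw : ∀ i, ‖w i‖ ≤ 1)
    (hf : Set.InjOn f {i | w i ≠ 0}) : lp (fun _ : ι => ℂ) 2 →L[ℂ] lp (fun _ : ι => ℂ) 2 :=
  LinearMap.mkContinuous
    { toFun := fun ψ => ⟨fun i => w i * ψ (f i),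
        memℓp_gen' (weightedShift_sum_le f w hw hf ψ)⟩
      map_add' := fun φ ψ => by
        ext i
        exact mul_add (w i) (φ (f i)) (ψ (f i))
      map_smul' := fun c ψ => by
        ext i
        simp [mul_left_comm] }
    1 (fun ψ => by
      rw [one_mul]
      exact lp.norm_le_of_forall_sum_le (by norm_num) (norm_nonneg _)
        (weightedShift_sum_le f w hw hf ψ))

theorem weightedShift_apply (f : ι → ι) (w : ι → ℂ) (hw : ∀ i, ‖w i‖ ≤ 1)
    (hf : Set.InjOn f {i | w i ≠ 0}) (ψ : lp (fun _ : ι => ℂ) 2) (i : ι) :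
    weightedShift f w hw hf ψ i = w i * ψ (f i) := rfl

theorem star_weightedShift {f g : ι → ι} {w v : ι → ℂ} (hw : ∀ i, ‖w i‖ ≤ 1)
    (hf : Set.InjOn f {i | w i ≠ 0}) (hv : ∀ i, ‖v i‖ ≤ 1) (hg : Set.InjOn g {i | v i ≠ 0})
    (hfg : ∀ i, w i ≠ 0 → g (f i) = i ∧ v (f i) = star (w i))
    (hgf : ∀ i, v i ≠ 0 → f (g i) = i ∧ w (g i) = star (v i)) :
    star (weightedShift f w hw hf) = weightedShift g v hv hg := by
  rw [ContinuousLinearMap.star_eq_adjoint]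
  symm
  rw [ContinuousLinearMap.eq_adjoint_iff]
  intro φ ψ
  rw [lp.inner_eq_tsum, lp.inner_eq_tsum]
  symm
  refine tsum_eq_tsum_of_ne_zero_bij (fun i => g i) ?_ ?_ ?_
  · rintro ⟨i, hi⟩ ⟨j, hj⟩ h
    have hi' : v i ≠ 0 := fun h0 => hi (by simp [weightedShift_apply, h0])
    have hj' : v j ≠ 0 := fun h0 => hj (by simp [weightedShift_apply, h0])
    exact Subtype.ext (hg hi' hj' h)
  · intro i hi
    have hi' : w i ≠ 0 := fun h0 => hi (by simp [weightedShift_apply, h0])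
    refine ⟨⟨f i, ?_⟩, (hfg i hi').1⟩
    intro h
    apply hi
    simp only [weightedShift_apply, (hfg i hi').1, (hfg i hi').2] at h ⊢
    simp at h ⊢
    tauto
  · rintro ⟨i, hi⟩
    have hi' : v i ≠ 0 := fun h0 => hi (by simp [weightedShift_apply, h0])
    simp only [weightedShift_apply, (hgf i hi').1, (hgf i hi').2]
    simp [mul_comm, mul_left_comm]

/-- The unitary `(U ψ)(i) = w i * ψ (e i)` of `ℓ²(ι)`, for a bijection `e` and phases `w`. -/
def weightedPerm (e : ι ≃ ι) (w : ι → ℂ) (hw : ∀ i, ‖w i‖ = 1) :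
    unitary (lp (fun _ : ι => ℂ) 2 →L[ℂ] lp (fun _ : ι => ℂ) 2) :=
  ⟨weightedShift e w (fun i => (hw i).le) e.injective.injOn, by
    have hs : star (weightedShift e w (fun i => (hw i).le) e.injective.injOn)
        = weightedShift e.symm (fun i => star (w (e.symm i)))
          (fun i => by rw [norm_star]; exact (hw _).le) e.symm.injective.injOn :=
      star_weightedShift _ _ _ _ (fun i _ => by simp) (fun i _ => by simp)
    have h1 : ∀ i, star (w i) * w i = 1 := fun i => by
      have := RCLike.conj_mul (w i)
      simpa [hw i] using this
    rw [Unitary.mem_iff, hs]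
    constructor <;> ext ψ i
    · change star (w (e.symm i)) * (w (e.symm i) * ψ (e (e.symm i))) = ψ i
      rw [← mul_assoc, h1, one_mul, e.apply_symm_apply]
    · change w i * (star (w (e.symm (e i))) * ψ (e.symm (e i))) = ψ i
      rw [e.symm_apply_apply, ← mul_assoc, mul_comm (w i), h1, one_mul]⟩

theorem weightedPerm_apply (e : ι ≃ ι) (w : ι → ℂ) (hw : ∀ i, ‖w i‖ = 1)
    (ψ : lp (fun _ : ι => ℂ) 2) (i : ι) :
    (weightedPerm e w hw : lp (fun _ : ι => ℂ) 2 →L[ℂ] lp (fun _ : ι => ℂ) 2) ψ i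
      = w i * ψ (e i) := rfl

end WeightedShift


/-- The lattice `ℤᵈ`. -/
abbrev Site (d : ℕ) : Type := Fin d → ℤ

/-- The Euclidean length `|x|` of a lattice site. -/
def len {d : ℕ} (x : Site d) : ℝ := Real.sqrt (∑ i, (x i : ℝ) ^ 2)

/-- The cubic box `Λ_L = {x : |x₁|, …, |x_d| ≤ L}`. -/
def box (d : ℕ) (L : ℝ) : Finset (Site d) :=
  Finset.Icc (fun _ => -⌊L⌋) (fun _ => ⌊L⌋)

theorem mem_box {d : ℕ} {L : ℝ} {x : Site d} : x ∈ box d L ↔ ∀ i, |(x i : ℝ)| ≤ L := by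
  simp only [box, Finset.mem_Icc, Pi.le_def, ← forall_and, abs_le]
  refine forall_congr' fun i => and_congr ?_ Int.le_floor
  rw [neg_le, Int.le_floor, Int.cast_neg, neg_le]

/-- The translated box `Λ_n + x`. -/
def shiftedBox {d : ℕ} (n : ℕ) (x : Site d) : Finset (Site d) :=
  (box d n).map (addRightEmbedding x)

/-! ### The lattice CAR algebra in its Fock representation

The antisymmetric Fock space over `ℓ²(ℤᵈ)` is `ℓ²` of the set of finite subsets `S` of `ℤᵈ`: the
basis vector `e_S` is the normalized antisymmetric product of the one-particle vectors `e_y`,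
`y ∈ S`, taken in lexicographic order. -/

/-- The fermion Fock space over `ℓ²(ℤᵈ)`, in the occupation number basis. -/
abbrev Fock (d : ℕ) : Type := lp (fun _ : Finset (Site d) => ℂ) 2

/-- The strict lexicographic order of `ℤᵈ`. -/
def Precedes {d : ℕ} (y x : Site d) : Prop := ∃ i, (∀ j < i, y j = x j) ∧ y i < x i

theorem Precedes.asymm {d : ℕ} {x y : Site d} (h : Precedes x y) : ¬ Precedes y x := by
  rintro ⟨j, hj, hlt'⟩
  obtain ⟨i, hi, hlt⟩ := h
  rcases lt_trichotomy i j with h | h | h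
  · have := hj i h
    omega
  · subst h
    omega
  · have := hi j h
    omega

theorem precedes_total {d : ℕ} {x y : Site d} (h : x ≠ y) : Precedes x y ∨ Precedes y x := by
  classical
  have hne : (Finset.univ.filter fun i => x i ≠ y i).Nonempty := by
    obtain ⟨i, hi⟩ := Function.ne_iff.mp h
    exact ⟨i, by simpa using hi⟩
  obtain ⟨i, hi, hmin⟩ := Finset.exists_min_image _ id hne
  have heq : ∀ j < i, x j = y j := fun j hj => by
    by_contra hc
    exact absurd (hmin j (by simpa using hc)) (not_le.mpr hj)
  rcases lt_or_gt_of_ne (by simpa using hi : x i ≠ y i) with hlt | hlt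
  · exact Or.inl ⟨i, heq, hlt⟩
  · exact Or.inr ⟨i, fun j hj => (heq j hj).symm, hlt⟩

open Classical in
/-- The sign of moving the particle at `x` past the particles of `S` that precede it. -/
def fermiSign {d : ℕ} (x : Site d) (S : Finset (Site d)) : ℂ :=
  (-1) ^ (S.filter fun y => Precedes y x).card

theorem norm_fermiSign {d : ℕ} (x : Site d) (S : Finset (Site d)) : ‖fermiSign x S‖ = 1 := by
  simp [fermiSign]

/-- The annihilation operator at `x`: it sends `e_T` to `± e_{T \ {x}}` if `x ∈ T`, and to `0`
otherwise. -/
def annihilation {d : ℕ} (x : Site d) : Fock d →L[ℂ] Fock d :=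
  weightedShift (fun S => insert x S) (fun S => if x ∈ S then 0 else fermiSign x S)
    (fun S => by
      split_ifs
      · simp
      · exact (norm_fermiSign x S).le)
    (fun S hS T hT h => by
      have hS' : x ∉ S := fun hx => hS (if_pos hx)
      have hT' : x ∉ T := fun hx => hT (if_pos hx)
      rw [← Finset.erase_insert hS', ← Finset.erase_insert hT']
      exact congrArg (fun U => Finset.erase U x) h)

theorem annihilation_apply {d : ℕ} (x : Site d) (ψ : Fock d) (S : Finset (Site d)) :
    annihilation x ψ S = (if x ∈ S then 0 else fermiSign x S) * ψ (insert x S) := rfl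

theorem star_annihilation_apply {d : ℕ} (x : Site d) (ψ : Fock d) (S : Finset (Site d)) :
    (star (annihilation x) : Fock d →L[ℂ] Fock d) ψ S
      = (if x ∈ S then fermiSign x (S.erase x) else 0) * ψ (S.erase x) := by
  have hv : ∀ S : Finset (Site d), ‖if x ∈ S then fermiSign x (S.erase x) else 0‖ ≤ 1 := by
    intro S
    split_ifs
    · exact (norm_fermiSign _ _).le
    · simp
  have hg : Set.InjOn (fun S : Finset (Site d) => S.erase x)
      {S | (if x ∈ S then fermiSign x (S.erase x) else 0) ≠ 0} := by
    intro S hS T hT h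
    have hS' : x ∈ S := by_contra fun hx => hS (if_neg hx)
    have hT' : x ∈ T := by_contra fun hx => hT (if_neg hx)
    rw [← Finset.insert_erase hS', ← Finset.insert_erase hT']
    exact congrArg (fun U => insert x U) h
  have hstar : ∀ S : Finset (Site d), star (fermiSign x S) = fermiSign x S := by
    intro S
    simp [fermiSign]
  have hs : star (annihilation x) = weightedShift (fun S : Finset (Site d) => S.erase x)
      (fun S => if x ∈ S then fermiSign x (S.erase x) else 0) hv hg := by
    refine star_weightedShift _ _ hv hg ?_ ?_
    · intro S hS
      have hS' : x ∉ S := fun hx => hS (if_pos hx)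
      simp [hS', hstar]
    · intro S hS
      have hS' : x ∈ S := by_contra fun hx => hS (if_neg hx)
      simp [hS', hstar]
  rw [hs]
  rfl

theorem fermiSign_sq {d : ℕ} (x : Site d) (S : Finset (Site d)) :
    fermiSign x S * fermiSign x S = 1 := by
  simp [fermiSign, ← mul_pow]

open Classical in
theorem fermiSign_insert {d : ℕ} (x y : Site d) {S : Finset (Site d)} (hy : y ∉ S) :
    fermiSign x (insert y S) = (if Precedes y x then -1 else 1) * fermiSign x S := by
  unfold fermiSign
  rw [Finset.filter_insert]
  split_ifs with h
  · rw [Finset.card_insert_of_notMem (by simp [hy]), pow_succ, mul_comm]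
  · rw [one_mul]

theorem fermiSign_swap {d : ℕ} {x y : Site d} (hxy : x ≠ y) {S : Finset (Site d)}
    (hx : x ∉ S) (hy : y ∉ S) :
    fermiSign x S * fermiSign y (insert x S) = -(fermiSign y S * fermiSign x (insert y S)) := by
  rw [fermiSign_insert y x hx, fermiSign_insert x y hy]
  rcases precedes_total hxy with h | h
  · rw [if_pos h, if_neg h.asymm]
    ring
  · rw [if_neg h.asymm, if_pos h]
    ring

/-- The relation `a_x a_y + a_y a_x = 0`. -/
theorem annihilation_anticomm {d : ℕ} (x y : Site d) :
    annihilation x * annihilation y + annihilation y * annihilation x = 0 := by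
  ext ψ S
  change annihilation x (annihilation y ψ) S + annihilation y (annihilation x ψ) S = 0
  simp only [annihilation_apply, Finset.mem_insert]
  by_cases hxy : x = y
  · subst hxy
    simp
  by_cases hx : x ∈ S
  · simp [hx]
  by_cases hy : y ∈ S
  · simp [hy]
  have hyx : y ≠ x := fun h => hxy h.symm
  simp only [hx, hy, hxy, hyx, or_false, if_false, Finset.insert_comm y x S]
  rw [← mul_assoc, ← mul_assoc, fermiSign_swap hxy hx hy]
  ring

/-- The relation `a_x a_y^* + a_y^* a_x = δ_{x,y} 1`. -/
theorem annihilation_star_anticomm {d : ℕ} (x y : Site d) :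
    annihilation x * star (annihilation y) + star (annihilation y) * annihilation x
      = if x = y then 1 else 0 := by
  ext ψ S
  change annihilation x (star (annihilation y) ψ) S + star (annihilation y) (annihilation x ψ) S
    = (if x = y then (1 : Fock d →L[ℂ] Fock d) else 0) ψ S
  simp only [annihilation_apply, star_annihilation_apply, Finset.mem_insert, Finset.mem_erase]
  by_cases hxy : x = y
  · subst hxy
    by_cases hx : x ∈ S
    · simp [hx, ← mul_assoc, fermiSign_sq]
    · simp [hx, ← mul_assoc, fermiSign_sq]
  · have hyx : y ≠ x := fun h => hxy h.symm
    by_cases hx : x ∈ S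
    · simp [hx, hxy]
    by_cases hy : y ∈ S
    · obtain ⟨T, hyT, rfl⟩ : ∃ T, y ∉ T ∧ insert y T = S :=
        ⟨S.erase y, Finset.notMem_erase y S, Finset.insert_erase hy⟩
      have hxT : x ∉ T := fun h => hx (Finset.mem_insert_of_mem h)
      have h1 : (insert x (insert y T)).erase y = insert x T := by
        rw [Finset.insert_comm, Finset.erase_insert]
        simp [hyx, hyT]
      have h2 := fermiSign_swap hxy hxT hyT
      simp only [hx, hxy, hyT, h1, Finset.erase_insert hyT, if_false, if_true, or_true,
        Finset.mem_insert, and_false, zero_apply, or_false]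
      have h3 := fermiSign_sq y T
      have h4 := fermiSign_sq y (insert x T)
      have h5 : fermiSign x (insert y T) * fermiSign y (insert x T)
          = -(fermiSign y T * fermiSign x T) := by
        linear_combination fermiSign y (insert x T) * fermiSign y T * h2
          - fermiSign x (insert y T) * fermiSign y (insert x T) * h3
          - fermiSign x T * fermiSign y T * h4
      rw [← mul_assoc, h5]
      simp
      ring
    · simp [hx, hy, hxy, hyx]

/-- The `*`-automorphism of `B(F)` implemented by a unitary. -/
def conjAut {d : ℕ} (u : unitary (Fock d →L[ℂ] Fock d)) :
    (Fock d →L[ℂ] Fock d) ≃⋆ₐ[ℂ] (Fock d →L[ℂ] Fock d) :=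
  Unitary.conjStarAlgAut ℂ _ u

/-- The CAR algebra `𝒰` as a `C*`-subalgebra of `B(F)`: the norm closure of the `*`-algebra
generated by the unit and all annihilation operators. -/
def carSubalgebra (d : ℕ) : StarSubalgebra ℂ (Fock d →L[ℂ] Fock d) :=
  (StarAlgebra.adjoin ℂ (Set.range (annihilation (d := d)))).topologicalClosure

/-- The CAR `C*`-algebra `𝒰` of the lattice `ℤᵈ`. -/
abbrev CAR (d : ℕ) : Type := ↥(carSubalgebra d)

instance isClosed_carSubalgebra (d : ℕ) :
    IsClosed (carSubalgebra d : Set (Fock d →L[ℂ] Fock d)) :=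
  StarSubalgebra.isClosed_topologicalClosure _

instance completeSpace_CAR (d : ℕ) : CompleteSpace (CAR d) :=
  (isClosed_carSubalgebra d).completeSpace_coe

theorem annihilation_mem {d : ℕ} (x : Site d) : annihilation x ∈ carSubalgebra d :=
  StarSubalgebra.le_topologicalClosure _ (StarAlgebra.subset_adjoin ℂ _ ⟨x, rfl⟩)

/-- The generator `a_x` of `𝒰`. -/
def ann {d : ℕ} (x : Site d) : CAR d := ⟨annihilation x, annihilation_mem x⟩

theorem conjAut_mem {d : ℕ} (u : unitary (Fock d →L[ℂ] Fock d))
    (h : ∀ x : Site d, conjAut u (annihilation x) ∈ carSubalgebra d)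
    {b : Fock d →L[ℂ] Fock d} (hb : b ∈ carSubalgebra d) : conjAut u b ∈ carSubalgebra d := by
  have hc : Continuous (conjAut u) := by
    change Continuous fun b : Fock d →L[ℂ] Fock d =>
      (u : Fock d →L[ℂ] Fock d) * b * (star u : Fock d →L[ℂ] Fock d)
    fun_prop
  let φ : (Fock d →L[ℂ] Fock d) →⋆ₐ[ℂ] (Fock d →L[ℂ] Fock d) := (conjAut u).toStarAlgHom
  have hle : carSubalgebra d ≤ (carSubalgebra d).comap φ := by
    refine StarSubalgebra.topologicalClosure_minimal ?_ ?_
    · refine StarAlgebra.adjoin_le ?_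
      rintro _ ⟨x, rfl⟩
      exact h x
    · exact (isClosed_carSubalgebra d).preimage hc
  exact hle hb

/-- The restriction to `𝒰` of the automorphism implemented by a unitary `u` for which
`u · u^*` and `u^* · u` send all `a_x` to elements of `𝒰`. -/
def restrictAut {d : ℕ} (u : unitary (Fock d →L[ℂ] Fock d))
    (h : ∀ x : Site d, conjAut u (annihilation x) ∈ carSubalgebra d)
    (h' : ∀ x : Site d, conjAut (star u) (annihilation x) ∈ carSubalgebra d) :
    CAR d ≃⋆ₐ[ℂ] CAR d where
  toFun b := ⟨conjAut u b, conjAut_mem u h b.2⟩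
  invFun b := ⟨conjAut (star u) b, conjAut_mem (star u) h' b.2⟩
  left_inv b := Subtype.ext (by simp [conjAut, mul_assoc]; simp [← mul_assoc])
  right_inv b := Subtype.ext (by simp [conjAut, mul_assoc]; simp [← mul_assoc])
  map_mul' b c := Subtype.ext (map_mul (conjAut u) _ _)
  map_add' b c := Subtype.ext (map_add (conjAut u) _ _)
  map_star' b := Subtype.ext (map_star (conjAut u) _)
  map_smul' r b := Subtype.ext (map_smul (conjAut u) r _)


/-- The unitary of Fock space that sends `e_S` to `e_{S + v}`. -/
def translationUnitary {d : ℕ} (v : Site d) : unitary (Fock d →L[ℂ] Fock d) :=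
  weightedPerm (Equiv.finsetCongr (Equiv.addRight (-v))) (fun _ => 1) (fun _ => by simp)

theorem star_translationUnitary {d : ℕ} (v : Site d) :
    star (translationUnitary v) = translationUnitary (-v) := by
  rw [Unitary.star_eq_inv, inv_eq_iff_mul_eq_one]
  ext ψ S
  change (1 : ℂ) * (1 * ψ _) = ψ S
  rw [one_mul, one_mul]
  refine congrArg ψ ?_
  ext x
  simp

theorem conjAut_translationUnitary {d : ℕ} (v y : Site d) :
    conjAut (translationUnitary v) (annihilation y) = annihilation (y + v) := by
  classical
  have h : (translationUnitary v : Fock d →L[ℂ] Fock d) * annihilation y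
      = annihilation (y + v) * translationUnitary v := by
    ext ψ S
    have hins : (insert (y + v) S).map (Equiv.addRight (-v)).toEmbedding
        = insert y (S.map (Equiv.addRight (-v)).toEmbedding) := by
      simp [Finset.map_insert]
    have hmem : y ∈ S.map (Equiv.addRight (-v)).toEmbedding ↔ y + v ∈ S := by
      simp
    have hsign : fermiSign y (S.map (Equiv.addRight (-v)).toEmbedding) = fermiSign (y + v) S := by
      unfold fermiSign
      rw [Finset.filter_map, Finset.card_map]
      congr 3
      ext z
      simp only [Function.comp, Precedes, Equiv.toEmbedding_apply, Equiv.coe_addRight,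
        Pi.add_apply, Pi.neg_apply]
      refine exists_congr fun i => and_congr (forall_congr' fun j => forall_congr' fun _ => ?_) ?_
      · constructor <;> intro h <;> omega
      · constructor <;> intro h <;> omega
    change 1 * ((if y ∈ S.map (Equiv.addRight (-v)).toEmbedding then 0
        else fermiSign y (S.map (Equiv.addRight (-v)).toEmbedding))
          * ψ (insert y (S.map (Equiv.addRight (-v)).toEmbedding)))
      = (if y + v ∈ S then 0 else fermiSign (y + v) S)
          * (1 * ψ ((insert (y + v) S).map (Equiv.addRight (-v)).toEmbedding))
    rw [hins, hsign, one_mul, one_mul]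
    simp only [hmem]
  change (translationUnitary v : Fock d →L[ℂ] Fock d) * annihilation y
      * (star (translationUnitary v) : Fock d →L[ℂ] Fock d) = _
  rw [h, mul_assoc, Unitary.mul_star_self_of_mem (SetLike.coe_mem _), mul_one]

/-- The lattice translation `χ_v`, the `*`-automorphism of `𝒰` with `χ_v(a_y) = a_{y+v}`. -/
def translation {d : ℕ} (v : Site d) : CAR d ≃⋆ₐ[ℂ] CAR d :=
  restrictAut (translationUnitary v)
    (fun x => by
      rw [conjAut_translationUnitary]
      exact annihilation_mem _)
    (fun x => by
      rw [star_translationUnitary, conjAut_translationUnitary]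
      exact annihilation_mem _)

theorem translation_ann {d : ℕ} (v y : Site d) : translation v (ann y) = ann (y + v) :=
  Subtype.ext (conjAut_translationUnitary v y)

/-- The unitary `exp(iθN)` of Fock space, with `N` the particle number operator. -/
def gaugeUnitary (d : ℕ) (θ : ℝ) : unitary (Fock d →L[ℂ] Fock d) :=
  weightedPerm (Equiv.refl _) (fun S => Complex.exp (θ * S.card * Complex.I))
    (fun S => by
      have := Complex.norm_exp_ofReal_mul_I (θ * S.card)
      push_cast at this
      exact this)

theorem star_gaugeUnitary (d : ℕ) (θ : ℝ) : star (gaugeUnitary d θ) = gaugeUnitary d (-θ) := by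
  rw [Unitary.star_eq_inv, inv_eq_iff_mul_eq_one]
  ext ψ S
  change Complex.exp (θ * S.card * Complex.I) *
    (Complex.exp ((-θ : ℝ) * S.card * Complex.I) * ψ S) = ψ S
  rw [← mul_assoc, ← Complex.exp_add]
  simp

theorem conjAut_gaugeUnitary {d : ℕ} (θ : ℝ) (y : Site d) :
    conjAut (gaugeUnitary d θ) (annihilation y)
      = Complex.exp (-(θ * Complex.I)) • annihilation y := by
  have h : (gaugeUnitary d θ : Fock d →L[ℂ] Fock d) * annihilation y
      = Complex.exp (-(θ * Complex.I)) • annihilation y * gaugeUnitary d θ := by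
    ext ψ S
    change Complex.exp (θ * S.card * Complex.I) *
        ((if y ∈ S then 0 else fermiSign y S) * ψ (insert y S))
      = Complex.exp (-(θ * Complex.I)) * ((if y ∈ S then 0 else fermiSign y S) *
        (Complex.exp (θ * (insert y S).card * Complex.I) * ψ (insert y S)))
    by_cases hy : y ∈ S
    · simp [hy]
    · rw [Finset.card_insert_of_notMem hy]
      have : Complex.exp (θ * S.card * Complex.I) = Complex.exp (-(θ * Complex.I)) *
          Complex.exp (θ * ((S.card + 1 : ℕ) : ℂ) * Complex.I) := by
        rw [← Complex.exp_add]
        congr 1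
        push_cast
        ring
      rw [this]
      ring
  change (gaugeUnitary d θ : Fock d →L[ℂ] Fock d) * annihilation y
      * (star (gaugeUnitary d θ) : Fock d →L[ℂ] Fock d) = _
  rw [h, mul_assoc, Unitary.mul_star_self_of_mem (SetLike.coe_mem _), mul_one]

/-- The gauge automorphism `σ_θ`, the `*`-automorphism of `𝒰` with `σ_θ(a_y) = e^{-iθ} a_y`. -/
def gauge {d : ℕ} (θ : ℝ) : CAR d ≃⋆ₐ[ℂ] CAR d :=
  restrictAut (gaugeUnitary d θ)
    (fun x => by
      rw [conjAut_gaugeUnitary]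
      exact (carSubalgebra d).smul_mem (annihilation_mem _) _)
    (fun x => by
      rw [star_gaugeUnitary, conjAut_gaugeUnitary]
      exact (carSubalgebra d).smul_mem (annihilation_mem _) _)

theorem gauge_ann {d : ℕ} (θ : ℝ) (y : Site d) :
    gauge θ (ann y) = Complex.exp (-(θ * Complex.I)) • ann y :=
  Subtype.ext (conjAut_gaugeUnitary θ y)

/-- The local algebra `𝒰_Λ`: all finite sums of monomials in `1`, `a_x`, `a_x^*`, `x ∈ Λ`. -/
def localAlgebra {d : ℕ} (Λ : Finset (Site d)) : StarSubalgebra ℂ (CAR d) :=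
  StarAlgebra.adjoin ℂ (ann '' (Λ : Set (Site d)))

/-- Even elements: those fixed by `σ_π`. -/
def IsEven {d : ℕ} (B : CAR d) : Prop := gauge Real.pi B = B

/-! ### Interactions, potentials and dynamics -/

/-- An interaction: a family of even self-adjoint elements `Ψ_Λ ∈ 𝒰_Λ` with `Ψ_∅ = 0`. -/
structure Interaction (d : ℕ) where
  /-- The element `Ψ_Λ`. -/
  term : Finset (Site d) → CAR d
  isLocal : ∀ Λ, term Λ ∈ localAlgebra Λ
  isEven : ∀ Λ, IsEven (term Λ)
  isSelfAdjoint : ∀ Λ, IsSelfAdjoint (term Λ)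
  term_empty : term ∅ = 0

/-- A potential: a family of even self-adjoint elements `V_{x} ∈ 𝒰_{x}`. -/
structure Potential (d : ℕ) where
  /-- The element `V_{x}`. -/
  term : Site d → CAR d
  isLocal : ∀ x, term x ∈ localAlgebra {x}
  isEven : ∀ x, IsEven (term x)
  isSelfAdjoint : ∀ x, IsSelfAdjoint (term x)

/-- The convolution constant `D = sup_{x,y} ∑_z F(|x-z|) F(|z-y|) / F(|x-y|)` in `[0,∞]`. -/
def eConvConst (d : ℕ) (F : ℝ → ℝ) : ENNReal :=
  ⨆ (x : Site d) (y : Site d),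
    ∑' z : Site d, ENNReal.ofReal (F (len (x - z)) * F (len (z - y)) / F (len (x - y)))

/-- The convolution constant `D` as a real number. -/
def convConst (d : ℕ) (F : ℝ → ℝ) : ℝ := (eConvConst d F).toReal

/-- Decay functions: positive and non-increasing on `[0,∞)`, summable on the lattice, with finite
convolution constant. -/
structure IsDecayFunction (d : ℕ) (F : ℝ → ℝ) : Prop where
  pos : ∀ r, 0 ≤ r → 0 < F r
  antitone : AntitoneOn F (Set.Ici 0)
  summable : Summable fun x : Site d => F (len x)
  conv_lt_top : eConvConst d F < ⊤

/-- The norm `‖Ψ‖_𝒲 = sup_{x,y} ∑_{Λ ⊇ {x,y}} ‖Ψ_Λ‖ / F(|x-y|)` in `[0,∞]`. -/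
def Interaction.eNormW {d : ℕ} (F : ℝ → ℝ) (Ψ : Interaction d) : ENNReal :=
  ⨆ (x : Site d) (y : Site d),
    ∑' Λ : {Λ : Finset (Site d) // {x, y} ⊆ Λ}, ENNReal.ofReal (‖Ψ.term Λ‖ / F (len (x - y)))

/-- The norm `‖Ψ‖_𝒲` as a real number. -/
def Interaction.normW {d : ℕ} (F : ℝ → ℝ) (Ψ : Interaction d) : ℝ := (Ψ.eNormW F).toReal

/-- The Hamiltonian `H_L` of the box `Λ_L`. -/
def hamiltonian {d : ℕ} (Ψ : Interaction d) (V : Potential d) (L : ℝ) : CAR d :=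
  ∑ Λ ∈ (box d L).powerset, Ψ.term Λ + ∑ x ∈ box d L, V.term x

/-- The finite-volume dynamics `τ_t^{(L)}(B) = exp(itH_L) B exp(-itH_L)`. -/
def finiteDynamics {d : ℕ} (Ψ : Interaction d) (V : Potential d) (L t : ℝ) (B : CAR d) : CAR d :=
  NormedSpace.exp ((Complex.I * t) • hamiltonian Ψ V L) * B *
    NormedSpace.exp (-((Complex.I * t) • hamiltonian Ψ V L))

/-- The infinite-volume dynamics `τ_t(B) = lim_{L → ∞} τ_t^{(L)}(B)`. -/
def dynamics {d : ℕ} (Ψ : Interaction d) (V : Potential d) (t : ℝ) (B : CAR d) : CAR d :=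
  limUnder atTop fun L : ℝ => finiteDynamics Ψ V L t B

/-- The multi-commutator `[B_k, …, B_1, B_0]^{(k+1)}`. -/
def multiCommutator {A : Type*} [Ring A] (B : ℕ → A) : ℕ → A
  | 0 => B 0
  | k + 1 => B (k + 1) * multiCommutator B k - multiCommutator B k * B (k + 1)

/-! ### Trees and the remainder -/

/-- `trees k` is the set `𝒯_{k+1}` of trees with vertices `0, …, k`, as sets of bonds. -/
def trees : ℕ → Finset (Finset (Sym2 ℕ))
  | 0 => {∅}
  | k + 1 => (Finset.range (k + 1) ×ˢ trees k).image fun p => insert s(p.1, k + 1) p.2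

/-- The map `P_T`: for a tree `T` as above and a vertex `j ≥ 1`, the (unique) vertex `i < j` with
`{i, j} ∈ T`. -/
def parent (T : Finset (Sym2 ℕ)) (j : ℕ) : ℕ := sInf {i | i < j ∧ s(i, j) ∈ T}

/-- `ϰ_T({(n_j, x_j)}_{j=0}^k)`, the indicator that all boxes `Λ_{n_j} + x_j` and
`Λ_{n_i} + x_i`, `i = P_T(j)`, overlap. -/
def overlap {d : ℕ} (k : ℕ) (T : Finset (Sym2 ℕ)) (n : ℕ → ℕ) (x : ℕ → Site d) : ℝ :=
  ∏ j ∈ Finset.Icc 1 k,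
    if (shiftedBox (n j) (x j) ∩ shiftedBox (n (parent T j)) (x (parent T j))).Nonempty
    then 1 else 0

/-- The set `𝒮_{ℓ,k}` of strictly increasing maps `{ℓ, …, k} → {1, …, k}`. -/
abbrev IncMaps (l k : ℕ) : Type := {π : Finset.Icc l k → Finset.Icc 1 k // StrictMono π}

instance fintypeIncMaps (l k : ℕ) : Fintype (IncMaps l k) := Fintype.ofFinite _

/-- The remainder `ℜ_{T,α}`. The sum over `n` runs over all families `n_{π(i)} ≥ m_{π(i)} + 1`,
`i ∈ {ℓ, …, k}`; `Function.extend` sets `n_j = m_j` for `j` outside the range of `π`. -/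
def remainder {d : ℕ} (F : ℝ → ℝ) (k : ℕ) (T : Finset (Sym2 ℕ)) (m : ℕ → ℕ) (s : ℕ → ℝ)
    (x : ℕ → Site d) (α : ℝ) : ℝ :=
  ∑ l ∈ Finset.Icc 1 k, (2 * α) ^ (k - l + 1) *
    ∑ π : IncMaps l k,
      (∏ i : Finset.Icc l k, |s (π.1 i)| * Real.exp (4 * convConst d F * α * |s (π.1 i)|)) *
      ∑' n : (i : Finset.Icc l k) → {n : ℕ // m (π.1 i) + 1 ≤ n},
        ∑ z ∈ Fintype.piFinset fun i : Finset.Icc l k => box d (m (π.1 i)),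
          ∑ y ∈ Fintype.piFinset fun i : Finset.Icc l k =>
              box d ((n i : ℕ) : ℝ) \ box d (((n i : ℕ) : ℝ) - 1),
            overlap k T (Function.extend (fun i => (π.1 i : ℕ)) (fun i => (n i : ℕ)) m) x *
              ∏ i : Finset.Icc l k, F (len (z i - y i))

end MultiLR

end

/-!
A local observable evolves, up to a telescoping sum, into layers localized in growing boxes: the
`n`-th layer is the difference of the evolutions generated by the Hamiltonians of two consecutive
boxes. By Duhamel's formula this difference is an integral of commutators of the evolved observable
with interaction terms leaving the smaller box, and a Lieb–Robinson bound makes it as small as the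
coupling between the initial box and the `n`-th shell. The on-site potential preserves every local
algebra, so it does not enter the bound. Expanding every entry of a multi-commutator into layers
leaves multi-commutators of localized elements. Such a commutator vanishes as soon as the support of
one of its even entries is disjoint from all earlier supports; otherwise each support meets an
earlier one, and choosing such an earlier support for every entry produces a tree along which the
supports overlap.
-/

noncomputable section

namespace MultiLR

attribute [local instance] LieRing.ofAssociativeRing

section Commutators

theorem norm_lie_le {R : Type*} [SeminormedRing R] (B C : R) : ‖⁅B, C⁆‖ ≤ 2 * ‖B‖ * ‖C‖ := by
  rw [Ring.lie_def]
  calc ‖B * C - C * B‖ ≤ ‖B * C‖ + ‖C * B‖ := norm_sub_le _ _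
    _ ≤ ‖B‖ * ‖C‖ + ‖C‖ * ‖B‖ := add_le_add (norm_mul_le _ _) (norm_mul_le _ _)
    _ = 2 * ‖B‖ * ‖C‖ := by ring

theorem norm_lie_symm {R : Type*} [SeminormedRing R] (B C : R) : ‖⁅B, C⁆‖ = ‖⁅C, B⁆‖ := by
  rw [← lie_skew, norm_neg]

theorem map_ring_lie {R S Φ : Type*} [Ring R] [Ring S] [FunLike Φ R S] [RingHomClass Φ R S]
    (φ : Φ) (B C : R) : φ ⁅B, C⁆ = ⁅φ B, φ C⁆ := by
  simp only [Ring.lie_def, map_sub, map_mul]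

end Commutators

section Evolution

open Complex selfAdjoint

variable {A : Type*} [CStarAlgebra A]

/-- The evolution `B ↦ exp(itH) B exp(-itH)` generated by the self-adjoint element `H`, as a
`*`-automorphism. -/
def evolve (H : selfAdjoint A) (t : ℝ) : A ≃⋆ₐ[ℂ] A :=
  Unitary.conjStarAlgAut ℂ A (expUnitary (t • H))

theorem coe_expUnitary_smul (H : selfAdjoint A) (t : ℝ) :
    (expUnitary (t • H) : A) = NormedSpace.exp (t • (I • (H : A))) := by
  rw [expUnitary_coe, selfAdjoint.val_smul, smul_comm]

theorem star_expUnitary (H : selfAdjoint A) : star (expUnitary H) = expUnitary (-H) := by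
  rw [Unitary.star_eq_inv, inv_eq_iff_mul_eq_one, ← Commute.expUnitary_add, add_neg_cancel,
    expUnitary_zero]
  exact (Commute.refl (H : A)).neg_right

theorem evolve_apply (H : selfAdjoint A) (t : ℝ) (B : A) :
    evolve H t B =
      NormedSpace.exp (t • (I • (H : A))) * B * NormedSpace.exp (-(t • (I • (H : A)))) := by
  rw [evolve, Unitary.conjStarAlgAut_apply, ← Unitary.coe_star, star_expUnitary, ← neg_smul,
    coe_expUnitary_smul, coe_expUnitary_smul, neg_smul]

theorem norm_evolve (H : selfAdjoint A) (t : ℝ) (B : A) : ‖evolve H t B‖ = ‖B‖ :=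
  NonUnitalStarAlgHom.norm_map (evolve H t) (evolve H t).injective B

theorem evolve_zero (H : selfAdjoint A) (B : A) : evolve H 0 B = B := by
  simp [evolve_apply]

theorem evolve_neg_generator (H : selfAdjoint A) (t : ℝ) : evolve (-H) t = evolve H (-t) := by
  rw [evolve, evolve, smul_neg, neg_smul]

theorem symm_evolve (H : selfAdjoint A) (t : ℝ) : (evolve H t).symm = evolve H (-t) := by
  rw [evolve, Unitary.conjStarAlgAut_symm, star_expUnitary, evolve, neg_smul]

theorem evolve_neg_evolve (H : selfAdjoint A) (t : ℝ) (B : A) :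
    evolve H (-t) (evolve H t B) = B := by
  rw [← symm_evolve, StarAlgEquiv.symm_apply_apply]

theorem evolve_evolve_neg (H : selfAdjoint A) (t : ℝ) (B : A) :
    evolve H t (evolve H (-t) B) = B := by
  rw [← symm_evolve, StarAlgEquiv.apply_symm_apply]

theorem norm_lie_evolve (H : selfAdjoint A) (t : ℝ) (B C : A) :
    ‖⁅evolve H t B, C⁆‖ = ‖⁅B, evolve H (-t) C⁆‖ := by
  rw [← norm_evolve H t ⁅B, _⁆, map_ring_lie, evolve_evolve_neg]

theorem evolve_eq_self_of_commute {H : selfAdjoint A} {B : A} (h : Commute (H : A) B) (t : ℝ) :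
    evolve H t B = B := by
  have hexp : Commute (expUnitary (t • H) : A) B := by
    rw [coe_expUnitary_smul]
    exact ((h.smul_left I).smul_left t).exp_left
  rw [evolve, Unitary.conjStarAlgAut_apply, hexp.eq, mul_assoc,
    Unitary.mul_star_self_of_mem (SetLike.coe_mem _), mul_one]

theorem evolve_add_of_commute {K N : selfAdjoint A} (h : Commute (K : A) (N : A)) (t : ℝ) (B : A) :
    evolve (K + N) t B = evolve K t (evolve N t B) := by
  have ht : Commute ((t • K : selfAdjoint A) : A) ((t • N : selfAdjoint A) : A) :=
    (h.smul_left t).smul_right t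
  rw [evolve, smul_add, ht.expUnitary_add, Unitary.conjStarAlgAut_mul_apply, evolve, evolve]

theorem evolve_mem {S : StarSubalgebra ℂ A} (hS : IsClosed (S : Set A)) {H : selfAdjoint A} {B : A}
    (hH : (H : A) ∈ S) (hB : B ∈ S) (t : ℝ) : evolve H t B ∈ S := by
  let : NormedAlgebra ℚ A := NormedAlgebra.restrictScalars ℚ ℂ A
  have hx : t • (I • (H : A)) ∈ S := by
    rw [← Complex.coe_smul]
    exact S.smul_mem (S.smul_mem hH _) _
  rw [evolve_apply]
  exact mul_mem (mul_mem (NormedSpace.exp_mem (R := ℂ) hS hx) hB)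
    (NormedSpace.exp_mem (R := ℂ) hS (neg_mem hx))

theorem hasDerivAt_evolve (H : selfAdjoint A) {X : ℝ → A} {X' : A} {t : ℝ}
    (hX : HasDerivAt X X' t) :
    HasDerivAt (fun u => evolve H u (X u)) (evolve H t (X' + I • ⁅(H : A), X t⁆)) t := by
  have hexp := hasDerivAt_exp_smul_const (I • (H : A)) t
  have hexp_neg := hasDerivAt_exp_smul_const' (-(I • (H : A))) t
  simp only [smul_neg] at hexp_neg
  simp only [evolve_apply]
  refine ((hexp.mul hX).mul hexp_neg).congr_deriv ?_
  simp only [Ring.lie_def, smul_sub, mul_add, add_mul, mul_sub, sub_mul, smul_mul_assoc,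
    mul_smul_comm, neg_mul, mul_neg, mul_assoc, Pi.mul_apply]
  abel

theorem continuous_evolve (H : selfAdjoint A) {X : ℝ → A} (hX : Continuous X) :
    Continuous fun t => evolve H t (X t) := by
  have hexp (a : A) : Continuous fun t : ℝ => NormedSpace.exp (t • a) :=
    continuous_iff_continuousAt.mpr fun t => (hasDerivAt_exp_smul_const a t).continuousAt
  simp only [evolve_apply, ← smul_neg]
  exact ((hexp _).mul hX).mul (hexp _)

theorem continuous_norm_lie_evolve (H : selfAdjoint A) (B C : A) :
    Continuous fun t => ‖⁅evolve H t B, C⁆‖ := by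
  have h := continuous_evolve H (continuous_const (y := B))
  simp only [Ring.lie_def]
  fun_prop

-- Duhamel: integrate the derivative of `u ↦ evolve G (-u) (evolve H u B)`.
theorem norm_evolve_sub_evolve_le (H G : selfAdjoint A) (B : A) {t : ℝ} (ht : 0 ≤ t) :
    ‖evolve H t B - evolve G t B‖ ≤ ∫ u in (0 : ℝ)..t, ‖⁅evolve H u B, (↑(H - G) : A)⁆‖ := by
  have hderiv : ∀ u, HasDerivAt (fun u => evolve (-G) u (evolve H u B))
      (evolve (-G) u (I • ⁅(↑(H - G) : A), evolve H u B⁆)) u := fun u => by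
    have hH := hasDerivAt_evolve H (hasDerivAt_const u B)
    have hcomm : ⁅(H : A), evolve H u B⁆ = evolve H u ⁅(H : A), B⁆ := by
      rw [map_ring_lie, evolve_eq_self_of_commute (Commute.refl _)]
    refine (hasDerivAt_evolve (-G) hH).congr_deriv (congrArg _ ?_)
    rw [zero_add, map_smul, ← hcomm, AddSubgroupClass.coe_sub, sub_lie,
      NegMemClass.coe_neg, neg_lie, ← smul_add, ← sub_eq_add_neg]
  have hcont : Continuous fun u => evolve (-G) u (I • ⁅(↑(H - G) : A), evolve H u B⁆) := by
    have hX : Continuous fun u => ⁅(↑(H - G) : A), evolve H u B⁆ := by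
      have h := continuous_evolve H (continuous_const (y := B))
      simp only [Ring.lie_def]
      fun_prop
    exact continuous_evolve _ (hX.const_smul I)
  have hint := intervalIntegral.integral_eq_sub_of_hasDerivAt (a := 0) (b := t)
    (fun u _ => hderiv u) (hcont.intervalIntegrable _ _)
  calc ‖evolve H t B - evolve G t B‖ = ‖evolve (-G) t (evolve H t B - evolve G t B)‖ :=
        (norm_evolve _ _ _).symm
    _ = ‖∫ u in (0 : ℝ)..t, evolve (-G) u (I • ⁅(↑(H - G) : A), evolve H u B⁆)‖ := by
        rw [hint, map_sub, evolve_neg_generator, evolve_neg_evolve, evolve_zero, evolve_zero]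
    _ ≤ ∫ u in (0 : ℝ)..t, ‖evolve (-G) u (I • ⁅(↑(H - G) : A), evolve H u B⁆)‖ :=
        intervalIntegral.norm_integral_le_integral_norm ht
    _ = ∫ u in (0 : ℝ)..t, ‖⁅evolve H u B, (↑(H - G) : A)⁆‖ := by
        simp only [norm_evolve, norm_smul, Complex.norm_I, one_mul, norm_lie_symm (↑(H - G) : A)]

theorem norm_lie_evolve_add_add_le (K N R : selfAdjoint A) {B : A} (hKN : Commute (K : A) (N : A))
    (hNB : Commute (N : A) B) (C : A) {t : ℝ} (ht : 0 ≤ t) :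
    ‖⁅evolve (K + N + R) t B, C⁆‖ ≤ ‖⁅evolve K t B, C⁆‖
      + 2 * ‖B‖ * ∫ u in (0 : ℝ)..t, ‖⁅evolve (K + N + R) u (R : A), C⁆‖ := by
  set H := K + N + R
  have hKNB : evolve K t B = evolve (K + N) t B := by
    rw [evolve_add_of_commute hKN, evolve_eq_self_of_commute hNB]
  have hR : -H - -(K + N) = -R := by simp only [H]; abel
  have hduhamel : ‖evolve H (-t) C - evolve (K + N) (-t) C‖
      ≤ ∫ u in (0 : ℝ)..t, ‖⁅evolve H u (R : A), C⁆‖ := by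
    have hintegrand : ∀ u, ‖⁅evolve (-H) u C, ((-R : selfAdjoint A) : A)⁆‖
        = ‖⁅evolve H u (R : A), C⁆‖ := fun u => by
      rw [NegMemClass.coe_neg, lie_neg, norm_neg, norm_lie_symm, evolve_neg_generator,
        ← norm_lie_evolve]
    have h := norm_evolve_sub_evolve_le (-H) (-(K + N)) C ht
    simp only [hR, hintegrand] at h
    rwa [evolve_neg_generator, evolve_neg_generator] at h
  calc ‖⁅evolve H t B, C⁆‖
      = ‖⁅B, evolve (K + N) (-t) C⁆ + ⁅B, evolve H (-t) C - evolve (K + N) (-t) C⁆‖ := by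
        rw [norm_lie_evolve, ← lie_add, add_sub_cancel]
    _ ≤ ‖⁅B, evolve (K + N) (-t) C⁆‖ + ‖⁅B, evolve H (-t) C - evolve (K + N) (-t) C⁆‖ :=
        norm_add_le _ _
    _ ≤ ‖⁅evolve K t B, C⁆‖ + 2 * ‖B‖ * ∫ u in (0 : ℝ)..t, ‖⁅evolve H u (R : A), C⁆‖ := by
        rw [← norm_lie_evolve, ← hKNB]
        gcongr
        exact (norm_lie_le _ _).trans (by gcongr)

end Evolution

section Locality

variable {d : ℕ}

theorem dense_adjoin_ann :
    Dense (StarAlgebra.adjoin ℂ (Set.range (ann (d := d))) : Set (CAR d)) := by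
  intro B
  have himage : Subtype.val '' (StarAlgebra.adjoin ℂ (Set.range (ann (d := d))) : Set (CAR d))
      = StarAlgebra.adjoin ℂ (Set.range (annihilation (d := d))) := by
    rw [← StarSubalgebra.coe_subtype, ← StarSubalgebra.coe_map, StarAlgHom.map_adjoin,
      ← Set.range_comp]
    rfl
  rw [closure_subtype, himage]
  exact B.2

theorem localAlgebra_mono {X Y : Finset (Site d)} (h : X ⊆ Y) : localAlgebra X ≤ localAlgebra Y :=
  StarAlgebra.adjoin_mono (Set.image_mono (Finset.coe_subset.mpr h))

theorem ann_mem_localAlgebra {X : Finset (Site d)} {y : Site d} (hy : y ∈ X) :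
    ann y ∈ localAlgebra X :=
  StarAlgebra.subset_adjoin ℂ _ ⟨y, hy, rfl⟩

theorem dense_iUnion_localAlgebra :
    Dense (⋃ X : Finset (Site d), (localAlgebra X : Set (CAR d))) := by
  classical
  refine dense_adjoin_ann.mono fun B hB => Set.mem_iUnion.mpr ?_
  have hunion {b c : CAR d} : (∃ X : Finset (Site d), b ∈ localAlgebra X) →
      (∃ Y : Finset (Site d), c ∈ localAlgebra Y) →
      ∃ X : Finset (Site d), b ∈ localAlgebra X ∧ c ∈ localAlgebra X := by
    rintro ⟨X, hb⟩ ⟨Y, hc⟩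
    exact ⟨X ∪ Y, localAlgebra_mono Finset.subset_union_left hb,
      localAlgebra_mono Finset.subset_union_right hc⟩
  induction hB using StarAlgebra.adjoin_induction with
  | mem b hb =>
    obtain ⟨y, rfl⟩ := hb
    exact ⟨{y}, ann_mem_localAlgebra (Finset.mem_singleton_self y)⟩
  | algebraMap r => exact ⟨∅, algebraMap_mem _ r⟩
  | add b c _ _ hb hc => exact (hunion hb hc).imp fun X h => add_mem h.1 h.2
  | mul b c _ _ hb hc => exact (hunion hb hc).imp fun X h => mul_mem h.1 h.2
  | star b _ hb => exact hb.imp fun X h => star_mem h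

/-- The `C*`-algebra of the region `X`. -/
def localClosure (X : Finset (Site d)) : StarSubalgebra ℂ (CAR d) :=
  (localAlgebra X).topologicalClosure

theorem isClosed_localClosure (X : Finset (Site d)) : IsClosed (localClosure X : Set (CAR d)) :=
  StarSubalgebra.isClosed_topologicalClosure _

theorem localAlgebra_le_localClosure (X : Finset (Site d)) : localAlgebra X ≤ localClosure X :=
  StarSubalgebra.le_topologicalClosure _

theorem localClosure_mono {X Y : Finset (Site d)} (h : X ⊆ Y) : localClosure X ≤ localClosure Y :=
  StarSubalgebra.topologicalClosure_mono (localAlgebra_mono h)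

theorem gauge_pi_ann (y : Site d) : gauge Real.pi (ann y) = -ann y := by
  rw [gauge_ann, Complex.exp_neg, Complex.exp_pi_mul_I, inv_neg, inv_one, neg_one_smul]

/-- The `C*`-algebra of even elements. -/
def evenSubalgebra (d : ℕ) : StarSubalgebra ℂ (CAR d) :=
  StarAlgHom.equalizer (gauge Real.pi).toStarAlgHom (StarAlgHom.id ℂ (CAR d))

theorem mem_evenSubalgebra {B : CAR d} : B ∈ evenSubalgebra d ↔ IsEven B := Iff.rfl

theorem isClosed_evenSubalgebra (d : ℕ) : IsClosed (evenSubalgebra d : Set (CAR d)) :=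
  isClosed_eq (StarAlgEquiv.isometry (gauge (d := d) Real.pi)).continuous continuous_id

theorem ann_mul_ann (x y : Site d) : ann x * ann y = -(ann y * ann x) :=
  Subtype.ext (eq_neg_of_add_eq_zero_left (annihilation_anticomm x y))

theorem ann_mul_star_ann {x y : Site d} (h : x ≠ y) :
    ann x * star (ann y) = -(star (ann y) * ann x) :=
  Subtype.ext (eq_neg_of_add_eq_zero_left ((annihilation_star_anticomm x y).trans (if_neg h)))

-- Parity turns the anticommutation of generators at distinct sites into a twisted commutation that
-- is stable under products.
theorem mul_eq_mul_gauge_of_notMem {Z : Finset (Site d)} {y : Site d} (hy : y ∉ Z) {v : CAR d}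
    (hv : v = ann y ∨ v = star (ann y)) {B : CAR d} (hB : B ∈ localClosure Z) :
    B * v = v * gauge Real.pi B := by
  have hgenerator : ∀ b ∈ (ann '' (Z : Set (Site d))) ∪ star (ann '' (Z : Set (Site d))),
      b * v = v * gauge Real.pi b := by
    rintro b (⟨x, hx, rfl⟩ | ⟨x, hx, hb⟩)
    · have hxy : x ≠ y := fun h => hy (h ▸ hx)
      rw [gauge_pi_ann, mul_neg]
      rcases hv with rfl | rfl
      exacts [ann_mul_ann x y, ann_mul_star_ann hxy]
    · have hxy : x ≠ y := fun h => hy (h ▸ hx)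
      rw [← star_star b, ← hb, map_star, gauge_pi_ann, star_neg, mul_neg]
      rcases hv with rfl | rfl
      · rw [ann_mul_star_ann hxy.symm, neg_neg]
      · rw [← star_mul, ann_mul_ann, star_neg, star_mul]
  have hgauge := (StarAlgEquiv.isometry (gauge (d := d) Real.pi)).continuous
  refine closure_minimal (t := {B | B * v = v * gauge Real.pi B}) (fun B hB => ?_)
    (isClosed_eq (by fun_prop) (by fun_prop)) hB
  change B ∈ (localAlgebra Z).toSubalgebra at hB
  rw [localAlgebra, StarAlgebra.adjoin_toSubalgebra] at hB
  change B * v = v * gauge Real.pi B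
  induction hB using Algebra.adjoin_induction with
  | mem b hb => exact hgenerator b hb
  | algebraMap r => rw [Algebra.algebraMap_eq_smul_one, map_smul, map_one, smul_mul_assoc,
      mul_smul_comm, one_mul, mul_one]
  | add b c _ _ hb hc => rw [map_add, add_mul, mul_add, hb, hc]
  | mul b c _ _ hb hc => rw [map_mul, mul_assoc, hc, ← mul_assoc, hb, mul_assoc]

theorem IsEven.commute {Z Y : Finset (Site d)} (hZY : Disjoint Z Y) {B C : CAR d}
    (hB : B ∈ localClosure Z) (hC : C ∈ localClosure Y) (he : IsEven B) : Commute B C := by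
  have hle : localClosure Y ≤ StarSubalgebra.centralizer ℂ {B} := by
    refine StarSubalgebra.topologicalClosure_minimal (StarAlgebra.adjoin_le ?_)
      (Set.isClosed_centralizer _)
    rintro _ ⟨y, hy, rfl⟩
    have hyZ := Finset.disjoint_right.mp hZY hy
    rw [SetLike.mem_coe, StarSubalgebra.mem_centralizer_iff]
    rintro _ rfl
    constructor
    · rw [mul_eq_mul_gauge_of_notMem hyZ (.inl rfl) hB, he]
    · rw [mul_eq_mul_gauge_of_notMem hyZ (.inl rfl) (star_mem hB), map_star, he]
  exact ((StarSubalgebra.mem_centralizer_iff ℂ).mp (hle hC) _ rfl).1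

theorem translation_mem_localAlgebra (v : Site d) {X : Finset (Site d)} {B : CAR d}
    (hB : B ∈ localAlgebra X) :
    translation v B ∈ localAlgebra (X.map (addRightEmbedding v)) := by
  have hle : localAlgebra X ≤ (localAlgebra (X.map (addRightEmbedding v))).comap
      (translation v).toStarAlgHom := by
    refine StarAlgebra.adjoin_le ?_
    rintro _ ⟨y, hy, rfl⟩
    change translation v (ann y) ∈ localAlgebra (X.map (addRightEmbedding v))
    rw [translation_ann]
    exact ann_mem_localAlgebra (Finset.mem_map_of_mem (addRightEmbedding v) hy)
  exact hle hB

theorem gauge_pi_translation (v : Site d) (B : CAR d) :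
    gauge Real.pi (translation v B) = translation v (gauge Real.pi B) := by
  let φ : CAR d →⋆ₐ[ℂ] CAR d := (gauge Real.pi).toStarAlgHom.comp (translation v).toStarAlgHom
  let ψ : CAR d →⋆ₐ[ℂ] CAR d := (translation v).toStarAlgHom.comp (gauge Real.pi).toStarAlgHom
  have hgenerators : Set.EqOn φ ψ (Set.range ann) := by
    rintro _ ⟨y, rfl⟩
    change gauge Real.pi (translation v (ann y)) = translation v (gauge Real.pi (ann y))
    rw [translation_ann, gauge_pi_ann, gauge_pi_ann, map_neg, translation_ann]
  have hgauge := (StarAlgEquiv.isometry (gauge (d := d) Real.pi)).continuous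
  have htranslation := (StarAlgEquiv.isometry (translation (d := d) v)).continuous
  exact congrFun (Continuous.ext_on dense_adjoin_ann (hgauge.comp htranslation)
    (htranslation.comp hgauge) fun _ h => StarAlgHom.adjoin_le_equalizer φ ψ hgenerators h) B

theorem IsEven.translation {B : CAR d} (he : IsEven B) (v : Site d) :
    IsEven (translation v B) := by
  rw [IsEven, gauge_pi_translation, he]

end Locality

/-- A quantum lattice system on the set of sites `σ`: a net of `C*`-algebras `loc X`, an interaction
`inter` and an on-site potential `pot` whose terms commute with the algebras of disjoint regions. It
isolates the part of the argument in which the fermionic structure plays no role. -/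
structure LocalModel (A : Type*) [CStarAlgebra A] (σ : Type*) [DecidableEq σ] where
  loc : Finset σ → StarSubalgebra ℂ A
  inter : Finset σ → selfAdjoint A
  pot : σ → selfAdjoint A
  isClosed_loc : ∀ X, IsClosed (loc X : Set A)
  loc_mono : ∀ {X Y}, X ⊆ Y → loc X ≤ loc Y
  inter_mem : ∀ Z, (inter Z : A) ∈ loc Z
  pot_mem : ∀ x, (pot x : A) ∈ loc {x}
  inter_commute : ∀ {Z X}, Disjoint Z X → ∀ {B}, B ∈ loc X → Commute (inter Z : A) B
  pot_commute : ∀ {x X}, x ∉ X → ∀ {B}, B ∈ loc X → Commute (pot x : A) B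

section Kernel

variable {σ : Type*}

/-- The total coupling `∑_{x ∈ X} ∑_{y ∈ S} G(x, y)` of two regions through the kernel `G`. -/
def kernelSum (G : σ → σ → ℝ) (X S : Finset σ) : ℝ := ∑ x ∈ X, ∑ y ∈ S, G x y

theorem kernelSum_nonneg {G : σ → σ → ℝ} (hG : ∀ x y, 0 ≤ G x y) (X S : Finset σ) :
    0 ≤ kernelSum G X S :=
  Finset.sum_nonneg fun x _ => Finset.sum_nonneg fun y _ => hG x y

variable [DecidableEq σ]

/-- The subregions of `Λ` that meet `X`. -/
def meeting (Λ X : Finset σ) : Finset (Finset σ) := {Z ∈ Λ.powerset | ¬Disjoint Z X}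

theorem mem_meeting {Λ X Z : Finset σ} : Z ∈ meeting Λ X ↔ Z ⊆ Λ ∧ ¬Disjoint Z X := by
  rw [meeting, Finset.mem_filter, Finset.mem_powerset]

theorem sum_le_sum_sum_filter_mem {X : Finset σ} {𝒵 : Finset (Finset σ)}
    (h𝒵 : ∀ Z ∈ 𝒵, ¬Disjoint Z X) {g : Finset σ → ℝ} (hg : ∀ Z, 0 ≤ g Z) :
    ∑ Z ∈ 𝒵, g Z ≤ ∑ x ∈ X, ∑ Z ∈ 𝒵 with x ∈ Z, g Z := by
  simp only [Finset.sum_filter]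
  rw [Finset.sum_comm]
  refine Finset.sum_le_sum fun Z hZ => ?_
  obtain ⟨x, hxZ, hxX⟩ := Finset.not_disjoint_iff.mp (h𝒵 Z hZ)
  calc g Z = if x ∈ Z then g Z else 0 := (if_pos hxZ).symm
    _ ≤ ∑ x ∈ X, if x ∈ Z then g Z else 0 :=
      Finset.single_le_sum (f := fun x => if x ∈ Z then g Z else 0)
        (fun y _ => by split_ifs; exacts [hg Z, le_rfl]) hxX

end Kernel

theorem integral_exp_add_pow (a b c : ℝ) (N : ℕ) (t : ℝ) :
    ∫ u in (0 : ℝ)..t, (b * a * Real.exp (a * u) + c * (u ^ N / N.factorial))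
      = b * (Real.exp (a * t) - 1) + c * (t ^ (N + 1) / (N + 1).factorial) := by
  have hderiv : ∀ u ∈ Set.uIcc 0 t, HasDerivAt
      (fun u : ℝ => b * Real.exp (a * u) + c * (u ^ (N + 1) / (N + 1).factorial))
      (b * a * Real.exp (a * u) + c * (u ^ N / N.factorial)) u := by
    intro u _
    have hexp := (((hasDerivAt_id u).const_mul a).exp).const_mul b
    have hpow := ((hasDerivAt_pow (N + 1) u).div_const ((N + 1).factorial : ℝ)).const_mul c
    refine (hexp.add hpow).congr_deriv ?_
    rw [Nat.factorial_succ]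
    push_cast
    simp only [id, mul_one]
    field_simp
  rw [intervalIntegral.integral_eq_sub_of_hasDerivAt hderiv
    (Continuous.intervalIntegrable (by fun_prop) _ _)]
  simp only [mul_zero, Real.exp_zero, zero_pow N.succ_ne_zero, zero_div]
  ring

namespace LocalModel

variable {A : Type*} [CStarAlgebra A] {σ : Type*} [DecidableEq σ]

/-- The Hamiltonian of a finite region. -/
def ham (M : LocalModel A σ) (Λ : Finset σ) : selfAdjoint A :=
  ∑ Z ∈ Λ.powerset, M.inter Z + ∑ x ∈ Λ, M.pot x

/-- The time-reversed system, which reduces negative times to positive ones. -/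
def reverse (M : LocalModel A σ) : LocalModel A σ where
  loc := M.loc
  inter Z := -M.inter Z
  pot x := -M.pot x
  isClosed_loc := M.isClosed_loc
  loc_mono := M.loc_mono
  inter_mem Z := neg_mem (M.inter_mem Z)
  pot_mem x := neg_mem (M.pot_mem x)
  inter_commute h _ hB := (M.inter_commute h hB).neg_left
  pot_commute h _ hB := (M.pot_commute h hB).neg_left

theorem ham_reverse (M : LocalModel A σ) (Λ : Finset σ) : M.reverse.ham Λ = -M.ham Λ := by
  simp only [ham, reverse, Finset.sum_neg_distrib, neg_add]

variable (M : LocalModel A σ)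

theorem sum_pot_mem (X : Finset σ) : ((∑ x ∈ X, M.pot x : selfAdjoint A) : A) ∈ M.loc X := by
  rw [AddSubgroup.val_finsetSum]
  exact sum_mem fun x hx => M.loc_mono (Finset.singleton_subset_iff.mpr hx) (M.pot_mem x)

theorem sum_inter_mem {Λ : Finset σ} {𝒵 : Finset (Finset σ)} (h𝒵 : ∀ Z ∈ 𝒵, Z ⊆ Λ) :
    ((∑ Z ∈ 𝒵, M.inter Z : selfAdjoint A) : A) ∈ M.loc Λ := by
  rw [AddSubgroup.val_finsetSum]
  exact sum_mem fun Z hZ => M.loc_mono (h𝒵 Z hZ) (M.inter_mem Z)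

theorem ham_mem (Λ : Finset σ) : (M.ham Λ : A) ∈ M.loc Λ :=
  add_mem (M.sum_inter_mem fun _ => Finset.mem_powerset.mp) (M.sum_pot_mem Λ)

theorem evolve_ham_mem {Λ : Finset σ} {B : A} (hB : B ∈ M.loc Λ) (t : ℝ) :
    evolve (M.ham Λ) t B ∈ M.loc Λ :=
  evolve_mem (M.isClosed_loc Λ) (M.ham_mem Λ) hB t

theorem sum_pot_commute {X Y : Finset σ} (h : Disjoint Y X) {B : A} (hB : B ∈ M.loc X) :
    Commute ((∑ x ∈ Y, M.pot x : selfAdjoint A) : A) B := by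
  rw [AddSubgroup.val_finsetSum]
  exact Commute.sum_left _ _ _ fun x hx => M.pot_commute (Finset.disjoint_left.mp h hx) hB

theorem sum_inter_commute {X : Finset σ} {𝒵 : Finset (Finset σ)} (h𝒵 : ∀ Z ∈ 𝒵, Disjoint Z X)
    {B : A} (hB : B ∈ M.loc X) : Commute ((∑ Z ∈ 𝒵, M.inter Z : selfAdjoint A) : A) B := by
  rw [AddSubgroup.val_finsetSum]
  exact Commute.sum_left _ _ _ fun Z hZ => M.inter_commute (h𝒵 Z hZ) hB

theorem lie_sum_inter (B : A) (𝒵 : Finset (Finset σ)) :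
    ⁅B, ((∑ Z ∈ 𝒵, M.inter Z : selfAdjoint A) : A)⁆ = ∑ Z ∈ 𝒵, ⁅B, (M.inter Z : A)⁆ := by
  rw [AddSubgroup.val_finsetSum, lie_sum]

-- The potential in `X` preserves the algebra of `X`, and everything that does not meet `X` commutes
-- with both: only the interaction terms meeting `X` contribute to the spreading.
theorem norm_lie_evolve_ham_le {Λ X : Finset σ} (hX : X ⊆ Λ) {B : A} (hB : B ∈ M.loc X) (C : A)
    {t : ℝ} (ht : 0 ≤ t) :
    ‖⁅evolve (M.ham Λ) t B, C⁆‖ ≤ ‖⁅evolve (∑ x ∈ X, M.pot x) t B, C⁆‖ + 2 * ‖B‖ *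
      ∫ u in (0 : ℝ)..t, ∑ W ∈ meeting Λ X, ‖⁅evolve (M.ham Λ) u (M.inter W : A), C⁆‖ := by
  set K := ∑ x ∈ X, M.pot x
  set N := ∑ x ∈ Λ \ X, M.pot x + ∑ W ∈ Λ.powerset with Disjoint W X, M.inter W
  set R := ∑ W ∈ meeting Λ X, M.inter W with hR
  have hham : M.ham Λ = K + N + R := by
    rw [ham, ← Finset.sum_sdiff hX, ← Finset.sum_filter_add_sum_filter_not Λ.powerset
      (fun W => Disjoint W X)]
    simp only [K, N, R, meeting]
    abel
  have hN {C : A} (hC : C ∈ M.loc X) : Commute (N : A) C :=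
    (M.sum_pot_commute Finset.sdiff_disjoint hC).add_left
      (M.sum_inter_commute (fun _ hW => (Finset.mem_filter.mp hW).2) hC)
  rw [hham]
  refine (norm_lie_evolve_add_add_le K N R (hN (M.sum_pot_mem X)).symm (hN hB) C ht).trans ?_
  gcongr
  refine intervalIntegral.integral_mono_on ht
    ((continuous_norm_lie_evolve _ _ _).intervalIntegrable _ _)
    ((continuous_finsetSum _ fun W _ => continuous_norm_lie_evolve _ _ _).intervalIntegrable _ _)
    fun u _ => ?_
  conv_lhs => rw [hR, AddSubgroup.val_finsetSum, map_sum, sum_lie]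
  exact norm_sum_le _ _

theorem ham_sub_ham_add_sum_pot {Λ Λ' : Finset σ} (hΛ : Λ ⊆ Λ') :
    M.ham Λ' - (M.ham Λ + ∑ x ∈ Λ' \ Λ, M.pot x) = ∑ Z ∈ meeting Λ' (Λ' \ Λ), M.inter Z := by
  have hpowerset : {Z ∈ Λ'.powerset | Disjoint Z (Λ' \ Λ)} = Λ.powerset := by
    ext Z
    rw [Finset.mem_filter, Finset.mem_powerset, Finset.mem_powerset]
    exact ⟨fun h => (disjoint_sdiff_iff_le h.1 hΛ).mp h.2,
      fun h => ⟨h.trans hΛ, (disjoint_sdiff_iff_le (h.trans hΛ) hΛ).mpr h⟩⟩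
  rw [ham, ham, ← Finset.sum_sdiff hΛ, ← hpowerset,
    ← Finset.sum_filter_add_sum_filter_not Λ'.powerset (fun Z => Disjoint Z (Λ' \ Λ)), meeting]
  abel

theorem evolve_ham_add_sum_pot {Λ Y : Finset σ} (h : Disjoint Y Λ) {B : A}
    (hB : B ∈ M.loc Λ) (t : ℝ) :
    evolve (M.ham Λ + ∑ x ∈ Y, M.pot x) t B = evolve (M.ham Λ) t B := by
  rw [evolve_add_of_commute (M.sum_pot_commute h (M.ham_mem Λ)).symm,
    evolve_eq_self_of_commute (M.sum_pot_commute h hB)]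

/-- The interaction decays like `α G(x, y)`, for a kernel `G` whose self-convolution is bounded
by `D G`. -/
structure HasDecay (G : σ → σ → ℝ) (α D : ℝ) : Prop where
  kernel_nonneg : ∀ x y, 0 ≤ G x y
  strength_nonneg : 0 ≤ α
  const_nonneg : 0 ≤ D
  sum_inter_le : ∀ x y (𝒵 : Finset (Finset σ)), (∀ Z ∈ 𝒵, x ∈ Z ∧ y ∈ Z) →
    ∑ Z ∈ 𝒵, ‖M.inter Z‖ ≤ α * G x y
  conv_le : ∀ x y (Λ : Finset σ), ∑ w ∈ Λ, G x w * G w y ≤ D * G x y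

namespace HasDecay

variable {M} {G : σ → σ → ℝ} {α D : ℝ}

theorem reverse (h : M.HasDecay G α D) : M.reverse.HasDecay G α D where
  kernel_nonneg := h.kernel_nonneg
  strength_nonneg := h.strength_nonneg
  const_nonneg := h.const_nonneg
  sum_inter_le x y 𝒵 h𝒵 := by
    simpa only [LocalModel.reverse, norm_neg] using h.sum_inter_le x y 𝒵 h𝒵
  conv_le := h.conv_le

theorem sum_norm_inter_le (h : M.HasDecay G α D) {X S : Finset σ} {𝒵 : Finset (Finset σ)}
    (hX : ∀ Z ∈ 𝒵, ¬Disjoint Z X) (hS : ∀ Z ∈ 𝒵, ¬Disjoint Z S) :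
    ∑ Z ∈ 𝒵, ‖M.inter Z‖ ≤ α * kernelSum G X S := by
  calc ∑ Z ∈ 𝒵, ‖M.inter Z‖ ≤ ∑ x ∈ X, ∑ Z ∈ 𝒵 with x ∈ Z, ‖M.inter Z‖ :=
        sum_le_sum_sum_filter_mem hX fun Z => norm_nonneg _
    _ ≤ ∑ x ∈ X, ∑ y ∈ S, ∑ Z ∈ {Z ∈ 𝒵 | x ∈ Z} with y ∈ Z, ‖M.inter Z‖ :=
        Finset.sum_le_sum fun x _ => sum_le_sum_sum_filter_mem
          (fun Z hZ => hS Z (Finset.mem_filter.mp hZ).1) fun Z => norm_nonneg _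
    _ ≤ ∑ x ∈ X, ∑ y ∈ S, α * G x y := by
        refine Finset.sum_le_sum fun x _ => Finset.sum_le_sum fun y _ =>
          h.sum_inter_le x y _ fun Z hZ => ?_
        simp only [Finset.mem_filter] at hZ
        exact ⟨hZ.1.2, hZ.2⟩
    _ = α * kernelSum G X S := by simp only [kernelSum, Finset.mul_sum]

theorem sum_norm_inter_mul_le_of_mem (h : M.HasDecay G α D) {Λ : Finset σ} (S : Finset σ) {x : σ}
    {𝒵 : Finset (Finset σ)} (hΛ : ∀ Z ∈ 𝒵, Z ⊆ Λ) (hx : ∀ Z ∈ 𝒵, x ∈ Z) :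
    ∑ Z ∈ 𝒵, ‖M.inter Z‖ * kernelSum G Z S ≤ α * (D * ∑ y ∈ S, G x y) := by
  calc ∑ Z ∈ 𝒵, ‖M.inter Z‖ * kernelSum G Z S
      = ∑ Z ∈ 𝒵, ∑ w ∈ Λ, if w ∈ Z then ‖M.inter Z‖ * ∑ y ∈ S, G w y else 0 := by
        refine Finset.sum_congr rfl fun Z hZ => ?_
        rw [← Finset.sum_filter, kernelSum, Finset.mul_sum, Finset.filter_mem_eq_inter,
          Finset.inter_eq_right.mpr (hΛ Z hZ)]
    _ = ∑ w ∈ Λ, (∑ Z ∈ 𝒵 with w ∈ Z, ‖M.inter Z‖) * ∑ y ∈ S, G w y := by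
        rw [Finset.sum_comm]
        simp only [← Finset.sum_filter, Finset.sum_mul]
    _ ≤ ∑ w ∈ Λ, α * G x w * ∑ y ∈ S, G w y := by
        refine Finset.sum_le_sum fun w _ => mul_le_mul_of_nonneg_right
          (h.sum_inter_le x w _ fun Z hZ => ?_) (Finset.sum_nonneg fun y _ => h.kernel_nonneg w y)
        exact ⟨hx Z (Finset.mem_filter.mp hZ).1, (Finset.mem_filter.mp hZ).2⟩
    _ = α * ∑ y ∈ S, ∑ w ∈ Λ, G x w * G w y := by
        rw [Finset.sum_comm, Finset.mul_sum]
        simp only [Finset.mul_sum, mul_assoc]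
    _ ≤ α * (D * ∑ y ∈ S, G x y) := by
        rw [Finset.mul_sum _ _ D]
        exact mul_le_mul_of_nonneg_left (Finset.sum_le_sum fun y _ => h.conv_le x y Λ)
          h.strength_nonneg

theorem sum_norm_inter_mul_le (h : M.HasDecay G α D) (Λ X S : Finset σ) :
    ∑ Z ∈ meeting Λ X, ‖M.inter Z‖ * kernelSum G Z S ≤ D * α * kernelSum G X S := by
  calc ∑ Z ∈ meeting Λ X, ‖M.inter Z‖ * kernelSum G Z S
      ≤ ∑ x ∈ X, ∑ Z ∈ meeting Λ X with x ∈ Z, ‖M.inter Z‖ * kernelSum G Z S :=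
        sum_le_sum_sum_filter_mem (fun Z hZ => (mem_meeting.mp hZ).2) fun Z =>
          mul_nonneg (norm_nonneg _) (kernelSum_nonneg h.kernel_nonneg Z S)
    _ ≤ ∑ x ∈ X, α * (D * ∑ y ∈ S, G x y) :=
        Finset.sum_le_sum fun x _ => h.sum_norm_inter_mul_le_of_mem S
          (fun Z hZ => (mem_meeting.mp (Finset.mem_filter.mp hZ).1).1)
          fun Z hZ => (Finset.mem_filter.mp hZ).2
    _ = D * α * kernelSum G X S := by
        rw [kernelSum, ← Finset.mul_sum, ← Finset.mul_sum]
        ring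

theorem sum_norm_lie_inter_le (h : M.HasDecay G α D) {X S : Finset σ} {𝒵 : Finset (Finset σ)}
    (h𝒵 : ∀ Z ∈ 𝒵, ¬Disjoint Z S) {B : A} (hB : B ∈ M.loc X) :
    ∑ Z ∈ 𝒵, ‖⁅B, (M.inter Z : A)⁆‖ ≤ ‖B‖ * (2 * α * kernelSum G X S) := by
  calc ∑ Z ∈ 𝒵, ‖⁅B, (M.inter Z : A)⁆‖
      ≤ ∑ Z ∈ 𝒵 with ¬Disjoint Z X, 2 * ‖B‖ * ‖M.inter Z‖ := by
        rw [Finset.sum_filter]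
        refine Finset.sum_le_sum fun Z _ => ?_
        split_ifs with hZX
        · rw [(M.inter_commute hZX hB).symm.lie_eq, norm_zero]
        · exact norm_lie_le _ _
    _ ≤ 2 * ‖B‖ * (α * kernelSum G X S) := by
        rw [← Finset.mul_sum]
        exact mul_le_mul_of_nonneg_left (h.sum_norm_inter_le
          (fun Z hZ => (Finset.mem_filter.mp hZ).2)
          (fun Z hZ => h𝒵 Z (Finset.mem_filter.mp hZ).1)) (by positivity)
    _ = ‖B‖ * (2 * α * kernelSum G X S) := by ring

theorem sum_norm_lie_evolve_le_add_integral (h : M.HasDecay G α D) {Λ S : Finset σ}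
    {𝒵 : Finset (Finset σ)} (h𝒵 : ∀ Z ∈ 𝒵, ¬Disjoint Z S) {X : Finset σ} (hX : X ⊆ Λ) {B : A}
    (hB : B ∈ M.loc X) {t : ℝ} (ht : 0 ≤ t) :
    ∑ Z ∈ 𝒵, ‖⁅evolve (M.ham Λ) t B, (M.inter Z : A)⁆‖ ≤ ‖B‖ * (2 * α * kernelSum G X S
      + 2 * ∫ u in (0 : ℝ)..t, ∑ W ∈ meeting Λ X, ∑ Z ∈ 𝒵,
          ‖⁅evolve (M.ham Λ) u (M.inter W : A), (M.inter Z : A)⁆‖) := by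
  have hstatic := h.sum_norm_lie_inter_le h𝒵
    (evolve_mem (M.isClosed_loc X) (M.sum_pot_mem X) hB t)
  rw [norm_evolve] at hstatic
  calc _ ≤ ∑ Z ∈ 𝒵, (‖⁅evolve (∑ x ∈ X, M.pot x) t B, (M.inter Z : A)⁆‖ + 2 * ‖B‖ *
        ∫ u in (0 : ℝ)..t, ∑ W ∈ meeting Λ X,
          ‖⁅evolve (M.ham Λ) u (M.inter W : A), (M.inter Z : A)⁆‖) :=
        Finset.sum_le_sum fun Z _ => M.norm_lie_evolve_ham_le hX hB _ ht
    _ ≤ ‖B‖ * (2 * α * kernelSum G X S) + 2 * ‖B‖ * ∫ u in (0 : ℝ)..t, ∑ W ∈ meeting Λ X,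
        ∑ Z ∈ 𝒵, ‖⁅evolve (M.ham Λ) u (M.inter W : A), (M.inter Z : A)⁆‖ := by
        rw [Finset.sum_add_distrib, ← Finset.mul_sum,
          ← intervalIntegral.integral_finsetSum fun Z _ => (continuous_finsetSum _ fun W _ =>
            continuous_norm_lie_evolve _ _ _).intervalIntegrable _ _]
        simp only [Finset.sum_comm (s := 𝒵)]
        gcongr
    _ = _ := by ring

theorem sum_meeting_le (h : M.HasDecay G α D) (Λ X S : Finset σ) {q : Finset σ → ℝ} {b r : ℝ}
    (hb : 0 ≤ b) (hr : 0 ≤ r)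
    (hq : ∀ W ⊆ Λ, q W ≤ ‖M.inter W‖ * (b * kernelSum G W S + r)) :
    ∑ W ∈ meeting Λ X, q W
      ≤ b * (D * α * kernelSum G X S) + (∑ W ∈ Λ.powerset, ‖M.inter W‖) * r := by
  calc ∑ W ∈ meeting Λ X, q W
      ≤ ∑ W ∈ meeting Λ X, ‖M.inter W‖ * (b * kernelSum G W S + r) :=
        Finset.sum_le_sum fun W hW => hq W (mem_meeting.mp hW).1
    _ = b * ∑ W ∈ meeting Λ X, ‖M.inter W‖ * kernelSum G W S
        + (∑ W ∈ meeting Λ X, ‖M.inter W‖) * r := by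
        rw [Finset.mul_sum, Finset.sum_mul, ← Finset.sum_add_distrib]
        exact Finset.sum_congr rfl fun W _ => by ring
    _ ≤ b * (D * α * kernelSum G X S) + (∑ W ∈ Λ.powerset, ‖M.inter W‖) * r := by
        gcongr
        · exact h.sum_norm_inter_mul_le Λ X S
        · exact Finset.filter_subset _ _

-- Iterating the integral inequality `N` times leaves an error of order `(c t) ^ N / N!`, where `c`
-- depends on the volume.
theorem sum_norm_lie_evolve_le_add (h : M.HasDecay G α D) {Λ S : Finset σ}
    {𝒵 : Finset (Finset σ)} (h𝒵 : ∀ Z ∈ 𝒵, ¬Disjoint Z S) (N : ℕ) {X : Finset σ} (hX : X ⊆ Λ)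
    {B : A} (hB : B ∈ M.loc X) {t : ℝ} (ht : 0 ≤ t) :
    ∑ Z ∈ 𝒵, ‖⁅evolve (M.ham Λ) t B, (M.inter Z : A)⁆‖ ≤ ‖B‖ *
      (2 * α * Real.exp (2 * D * α * t) * kernelSum G X S
        + (2 * ∑ Z ∈ 𝒵, ‖M.inter Z‖) * (2 * ∑ W ∈ Λ.powerset, ‖M.inter W‖) ^ N
          * (t ^ N / N.factorial)) := by
  have hα := h.strength_nonneg
  have hf := fun X => kernelSum_nonneg h.kernel_nonneg X S
  induction N generalizing X B t with
  | zero =>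
    calc ∑ Z ∈ 𝒵, ‖⁅evolve (M.ham Λ) t B, (M.inter Z : A)⁆‖
        ≤ ∑ Z ∈ 𝒵, 2 * ‖B‖ * ‖M.inter Z‖ := Finset.sum_le_sum fun Z _ =>
          (norm_lie_le (evolve (M.ham Λ) t B) _).trans_eq (by rw [norm_evolve]; rfl)
      _ = ‖B‖ * (2 * ∑ Z ∈ 𝒵, ‖M.inter Z‖) := by rw [← Finset.mul_sum]; ring
      _ ≤ _ := by
        simp only [pow_zero, Nat.factorial_zero, Nat.cast_one, div_one, mul_one]
        refine mul_le_mul_of_nonneg_left (le_add_of_nonneg_left ?_) (norm_nonneg _)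
        exact mul_nonneg (by positivity) (hf X)
  | succ N ih =>
    set c := 2 * ∑ W ∈ Λ.powerset, ‖M.inter W‖ with hc
    set m := 2 * ∑ Z ∈ 𝒵, ‖M.inter Z‖
    have hintegral : ∫ u in (0 : ℝ)..t, ∑ W ∈ meeting Λ X, ∑ Z ∈ 𝒵,
          ‖⁅evolve (M.ham Λ) u (M.inter W : A), (M.inter Z : A)⁆‖
        ≤ ∫ u in (0 : ℝ)..t, (α * kernelSum G X S * (2 * D * α) * Real.exp (2 * D * α * u)
          + m * c ^ N * (c / 2) * (u ^ N / N.factorial)) := by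
      refine intervalIntegral.integral_mono_on ht (Continuous.intervalIntegrable
        (continuous_finsetSum _ fun W _ => continuous_finsetSum _ fun Z _ =>
          continuous_norm_lie_evolve _ _ _) _ _) (Continuous.intervalIntegrable (by fun_prop) _ _)
        fun u hu => (h.sum_meeting_le Λ X S (by positivity) ?_ fun W hW =>
          ih hW (M.inter_mem W) hu.1).trans_eq (by rw [hc]; ring)
      exact mul_nonneg (by positivity) (div_nonneg (pow_nonneg hu.1 _) (Nat.cast_nonneg _))
    rw [integral_exp_add_pow] at hintegral
    refine (h.sum_norm_lie_evolve_le_add_integral h𝒵 hX hB ht).trans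
      (mul_le_mul_of_nonneg_left ?_ (norm_nonneg _))
    rw [pow_succ c]
    linarith

theorem sum_norm_lie_evolve_le (h : M.HasDecay G α D) {Λ S : Finset σ} {𝒵 : Finset (Finset σ)}
    (h𝒵 : ∀ Z ∈ 𝒵, ¬Disjoint Z S) {X : Finset σ} (hX : X ⊆ Λ) {B : A} (hB : B ∈ M.loc X) {t : ℝ}
    (ht : 0 ≤ t) :
    ∑ Z ∈ 𝒵, ‖⁅evolve (M.ham Λ) t B, (M.inter Z : A)⁆‖
      ≤ ‖B‖ * (2 * α * Real.exp (2 * D * α * t) * kernelSum G X S) := by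
  have hlim := (((FloorSemiring.tendsto_pow_div_factorial_atTop
    ((2 * ∑ W ∈ Λ.powerset, ‖M.inter W‖) * t)).const_mul (2 * ∑ Z ∈ 𝒵, ‖M.inter Z‖)).const_add
      (2 * α * Real.exp (2 * D * α * t) * kernelSum G X S)).const_mul ‖B‖
  rw [mul_zero, add_zero] at hlim
  refine ge_of_tendsto' hlim fun N => (h.sum_norm_lie_evolve_le_add h𝒵 N hX hB ht).trans_eq ?_
  rw [mul_pow]
  ring

theorem norm_evolve_sub_le_of_nonneg (h : M.HasDecay G α D) {X Λ Λ' : Finset σ} (hX : X ⊆ Λ)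
    (hΛ : Λ ⊆ Λ') {B : A} (hB : B ∈ M.loc X) {t : ℝ} (ht : 0 ≤ t) :
    ‖evolve (M.ham Λ') t B - evolve (M.ham Λ) t B‖
      ≤ ‖B‖ * (2 * α * (t * Real.exp (2 * D * α * t))) * kernelSum G X (Λ' \ Λ) := by
  have hα := h.strength_nonneg
  have hD := h.const_nonneg
  have hf := kernelSum_nonneg h.kernel_nonneg X (Λ' \ Λ)
  rw [← M.evolve_ham_add_sum_pot Finset.sdiff_disjoint (M.loc_mono hX hB)]
  calc _ ≤ ∫ u in (0 : ℝ)..t, ‖⁅evolve (M.ham Λ') u B,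
        (↑(M.ham Λ' - (M.ham Λ + ∑ x ∈ Λ' \ Λ, M.pot x)) : A)⁆‖ :=
        norm_evolve_sub_evolve_le _ _ B ht
    _ ≤ ∫ _u in (0 : ℝ)..t, ‖B‖ * (2 * α * Real.exp (2 * D * α * t)
        * kernelSum G X (Λ' \ Λ)) := by
        refine intervalIntegral.integral_mono_on ht
          ((continuous_norm_lie_evolve _ _ _).intervalIntegrable _ _)
          (continuous_const.intervalIntegrable _ _) fun u hu => ?_
        rw [M.ham_sub_ham_add_sum_pot hΛ, lie_sum_inter]
        refine (norm_sum_le _ _).trans ((h.sum_norm_lie_evolve_le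
          (fun Z hZ => (mem_meeting.mp hZ).2) (hX.trans hΛ) hB hu.1).trans ?_)
        gcongr
        exact hu.2
    _ = _ := by
        rw [intervalIntegral.integral_const, sub_zero, smul_eq_mul]
        ring

theorem norm_evolve_sub_le (h : M.HasDecay G α D) {X Λ Λ' : Finset σ} (hX : X ⊆ Λ)
    (hΛ : Λ ⊆ Λ') {B : A} (hB : B ∈ M.loc X) (t : ℝ) :
    ‖evolve (M.ham Λ') t B - evolve (M.ham Λ) t B‖
      ≤ ‖B‖ * (2 * α * (|t| * Real.exp (2 * D * α * |t|))) * kernelSum G X (Λ' \ Λ) := by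
  rcases le_total 0 t with ht | ht
  · rw [abs_of_nonneg ht]
    exact h.norm_evolve_sub_le_of_nonneg hX hΛ hB ht
  · rw [abs_of_nonpos ht]
    have hreverse := h.reverse.norm_evolve_sub_le_of_nonneg hX hΛ (B := B) hB (neg_nonneg.mpr ht)
    simpa only [ham_reverse, evolve_neg_generator, neg_neg] using hreverse

theorem cauchySeq_evolve_of_mem (h : M.HasDecay G α D) (hG : ∀ x, Summable (G x))
    {X : Finset σ} {B : A} (hB : B ∈ M.loc X) (t : ℝ) :
    CauchySeq fun Λ : Finset σ => evolve (M.ham Λ) t B := by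
  set c := ‖B‖ * (2 * α * (|t| * Real.exp (2 * D * α * |t|)))
  have hsum : Summable fun y => c * ∑ x ∈ X, G x y :=
    (summable_sum fun x _ => hG x).mul_left c
  rw [Metric.cauchySeq_iff']
  intro ε hε
  obtain ⟨s, hs⟩ := summable_iff_vanishing.mp hsum _ (Metric.ball_mem_nhds 0 hε)
  refine ⟨s ∪ X, fun Λ hΛ => ?_⟩
  have htail := hs (Λ \ (s ∪ X)) (Finset.disjoint_of_subset_right Finset.subset_union_left
    Finset.sdiff_disjoint)
  rw [mem_ball_zero_iff, Real.norm_eq_abs, ← Finset.mul_sum, Finset.sum_comm] at htail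
  rw [dist_eq_norm]
  exact (h.norm_evolve_sub_le Finset.subset_union_right hΛ hB t).trans_lt (lt_of_abs_lt htail)

theorem cauchySeq_evolve (h : M.HasDecay G α D) (hG : ∀ x, Summable (G x))
    (hdense : Dense (⋃ X, (M.loc X : Set A))) (B : A) (t : ℝ) :
    CauchySeq fun Λ : Finset σ => evolve (M.ham Λ) t B := by
  rw [Metric.cauchySeq_iff']
  intro ε hε
  obtain ⟨C, hC, hBC⟩ := hdense.exists_dist_lt B (ε := ε / 3) (by positivity)
  obtain ⟨X, hX⟩ := Set.mem_iUnion.mp hC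
  obtain ⟨s, hs⟩ := Metric.cauchySeq_iff'.mp (h.cauchySeq_evolve_of_mem hG hX t) (ε / 3)
    (by positivity)
  have hdist (Λ : Finset σ) : dist (evolve (M.ham Λ) t B) (evolve (M.ham Λ) t C) < ε / 3 := by
    rwa [dist_eq_norm, ← map_sub, norm_evolve, ← dist_eq_norm]
  refine ⟨s, fun Λ hΛ => ?_⟩
  calc dist (evolve (M.ham Λ) t B) (evolve (M.ham s) t B)
      ≤ dist (evolve (M.ham Λ) t B) (evolve (M.ham Λ) t C)
        + dist (evolve (M.ham Λ) t C) (evolve (M.ham s) t C)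
        + dist (evolve (M.ham s) t C) (evolve (M.ham s) t B) := dist_triangle4 _ _ _ _
    _ < ε / 3 + ε / 3 + ε / 3 := by
        rw [dist_comm (evolve (M.ham s) t C)]
        exact add_lt_add (add_lt_add (hdist Λ) (hs Λ hΛ)) (hdist s)
    _ = ε := by ring

end HasDecay

/-- The increments of the evolution of `B` along an exhaustion `R` of the lattice, started at the
region `R m`: the evolution in `R m` for `n = m`, and for `n > m` the difference of the evolutions
in `R n` and in `R (n - 1)`. -/
def layer (M : LocalModel A σ) (R : ℕ → Finset σ) (t : ℝ) (m : ℕ) (B : A) (n : ℕ) : A :=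
  if n = m then evolve (M.ham (R m)) t B
  else evolve (M.ham (R n)) t B - evolve (M.ham (R (n - 1))) t B

theorem sum_layer (R : ℕ → Finset σ) (t : ℝ) (B : A) {m N : ℕ} (hN : m ≤ N) :
    ∑ n ∈ Finset.Icc m N, M.layer R t m B n = evolve (M.ham (R N)) t B := by
  induction N, hN using Nat.le_induction with
  | base => rw [Finset.Icc_self, Finset.sum_singleton, layer, if_pos rfl]
  | succ N hN ih =>
    rw [Finset.sum_Icc_succ_top (by lia), ih, layer, if_neg (by lia), Nat.add_sub_cancel,
      add_sub_cancel]

theorem layer_mem {R : ℕ → Finset σ} (hR : Monotone R) (t : ℝ) {m : ℕ} {B : A}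
    (hB : B ∈ M.loc (R m)) {n : ℕ} (hn : m ≤ n) : M.layer R t m B n ∈ M.loc (R n) := by
  have hB_mem {n : ℕ} (hn : m ≤ n) : B ∈ M.loc (R n) := M.loc_mono (hR hn) hB
  unfold layer
  split_ifs with h
  · subst h
    exact M.evolve_ham_mem hB t
  · exact sub_mem (M.evolve_ham_mem (hB_mem hn) t)
      (M.loc_mono (hR (Nat.sub_le n 1)) (M.evolve_ham_mem (hB_mem (by lia)) t))

theorem norm_layer_self (R : ℕ → Finset σ) (t : ℝ) (m : ℕ) (B : A) : ‖M.layer R t m B m‖ = ‖B‖ := by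
  rw [layer, if_pos rfl, norm_evolve]

variable {M} in
theorem HasDecay.norm_layer_le (h : M.HasDecay G α D) {R : ℕ → Finset σ} (hR : Monotone R) (t : ℝ)
    {m : ℕ} {B : A} (hB : B ∈ M.loc (R m)) {n : ℕ} (hn : m < n) :
    ‖M.layer R t m B n‖ ≤ ‖B‖ * (2 * α * (|t| * Real.exp (2 * D * α * |t|)))
      * kernelSum G (R m) (R n \ R (n - 1)) := by
  rw [layer, if_neg hn.ne']
  exact h.norm_evolve_sub_le (hR (Nat.le_sub_one_of_lt hn)) (hR (Nat.sub_le n 1)) hB t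

end LocalModel

section Dynamics

variable {d : ℕ}

/-- The lattice fermion system with interaction `Ψ` and potential `V`. -/
def fermionModel (Ψ : Interaction d) (V : Potential d) : LocalModel (CAR d) (Site d) where
  loc := localClosure
  inter Z := ⟨Ψ.term Z, Ψ.isSelfAdjoint Z⟩
  pot x := ⟨V.term x, V.isSelfAdjoint x⟩
  isClosed_loc := isClosed_localClosure
  loc_mono h := localClosure_mono h
  inter_mem Z := localAlgebra_le_localClosure Z (Ψ.isLocal Z)
  pot_mem x := localAlgebra_le_localClosure {x} (V.isLocal x)
  inter_commute {Z _} h _ hB :=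
    (Ψ.isEven Z).commute h (localAlgebra_le_localClosure Z (Ψ.isLocal Z)) hB
  pot_commute {x _} h _ hB := (V.isEven x).commute (Finset.disjoint_singleton_left.mpr h)
    (localAlgebra_le_localClosure {x} (V.isLocal x)) hB

theorem coe_ham_fermionModel (Ψ : Interaction d) (V : Potential d) (Λ : Finset (Site d)) :
    ((fermionModel Ψ V).ham Λ : CAR d) = ∑ Z ∈ Λ.powerset, Ψ.term Z + ∑ x ∈ Λ, V.term x := by
  rw [LocalModel.ham, AddSubgroup.coe_add, AddSubgroup.val_finsetSum, AddSubgroup.val_finsetSum]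
  rfl

theorem finiteDynamics_eq_evolve (Ψ : Interaction d) (V : Potential d) (L t : ℝ) (B : CAR d) :
    finiteDynamics Ψ V L t B = evolve ((fermionModel Ψ V).ham (box d L)) t B := by
  rw [finiteDynamics, hamiltonian, evolve_apply, coe_ham_fermionModel, mul_comm, ← smul_smul,
    Complex.coe_smul]

theorem convConst_nonneg (d : ℕ) (F : ℝ → ℝ) : 0 ≤ convConst d F := ENNReal.toReal_nonneg

theorem normW_nonneg (F : ℝ → ℝ) (Ψ : Interaction d) : 0 ≤ Ψ.normW F := ENNReal.toReal_nonneg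

theorem IsDecayFunction.len_pos {F : ℝ → ℝ} (hF : IsDecayFunction d F) (x : Site d) :
    0 < F (len x) :=
  hF.pos _ (Real.sqrt_nonneg _)

theorem IsDecayFunction.sum_norm_term_le {F : ℝ → ℝ} (hF : IsDecayFunction d F) {Ψ : Interaction d}
    (hΨ : Ψ.eNormW F < ⊤) (x y : Site d) {𝒵 : Finset (Finset (Site d))}
    (h𝒵 : ∀ Z ∈ 𝒵, x ∈ Z ∧ y ∈ Z) :
    ∑ Z ∈ 𝒵, ‖Ψ.term Z‖ ≤ Ψ.normW F * F (len (x - y)) := by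
  have hpos := hF.len_pos (x - y)
  have hsubset : ∀ Z ∈ 𝒵, {x, y} ⊆ Z := fun Z hZ =>
    Finset.insert_subset_iff.mpr ⟨(h𝒵 Z hZ).1, Finset.singleton_subset_iff.mpr (h𝒵 Z hZ).2⟩
  rw [← div_le_iff₀ hpos, Finset.sum_div, Interaction.normW,
    ← ENNReal.ofReal_le_iff_le_toReal hΨ.ne,
    ENNReal.ofReal_sum_of_nonneg fun Z _ => by positivity]
  calc ∑ Z ∈ 𝒵, ENNReal.ofReal (‖Ψ.term Z‖ / F (len (x - y)))
      = ∑ Z ∈ 𝒵.subtype fun Z => {x, y} ⊆ Z, ENNReal.ofReal (‖Ψ.term Z‖ / F (len (x - y))) :=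
        (Finset.sum_subtype_of_mem (fun Z => ENNReal.ofReal (‖Ψ.term Z‖ / F (len (x - y))))
          hsubset).symm
    _ ≤ ∑' Λ : {Λ : Finset (Site d) // {x, y} ⊆ Λ},
        ENNReal.ofReal (‖Ψ.term Λ‖ / F (len (x - y))) := ENNReal.sum_le_tsum _
    _ ≤ Ψ.eNormW F := le_iSup₂ (f := fun x y : Site d =>
        ∑' Λ : {Λ : Finset (Site d) // {x, y} ⊆ Λ},
          ENNReal.ofReal (‖Ψ.term Λ‖ / F (len (x - y)))) x y

theorem IsDecayFunction.sum_mul_le {F : ℝ → ℝ} (hF : IsDecayFunction d F) (x y : Site d)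
    (Λ : Finset (Site d)) :
    ∑ w ∈ Λ, F (len (x - w)) * F (len (w - y)) ≤ convConst d F * F (len (x - y)) := by
  rw [← div_le_iff₀ (hF.len_pos (x - y)), Finset.sum_div, convConst,
    ← ENNReal.ofReal_le_iff_le_toReal hF.conv_lt_top.ne,
    ENNReal.ofReal_sum_of_nonneg fun w _ => div_nonneg
      (mul_nonneg (hF.len_pos _).le (hF.len_pos _).le) (hF.len_pos _).le]
  exact (ENNReal.sum_le_tsum Λ).trans (le_iSup₂ (f := fun x y : Site d =>
    ∑' z : Site d, ENNReal.ofReal (F (len (x - z)) * F (len (z - y)) / F (len (x - y)))) x y)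

theorem hasDecay_fermionModel {F : ℝ → ℝ} (hF : IsDecayFunction d F) {Ψ : Interaction d}
    (hΨ : Ψ.eNormW F < ⊤) (V : Potential d) :
    (fermionModel Ψ V).HasDecay (fun x y => F (len (x - y))) (Ψ.normW F) (convConst d F) where
  kernel_nonneg x y := (hF.len_pos (x - y)).le
  strength_nonneg := normW_nonneg F Ψ
  const_nonneg := convConst_nonneg d F
  sum_inter_le x y _ h𝒵 := hF.sum_norm_term_le hΨ x y h𝒵
  conv_le := hF.sum_mul_le

theorem box_mono : Monotone (box d) := fun _ _ h _ hx =>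
  mem_box.mpr fun i => (mem_box.mp hx i).trans h

theorem exists_mem_box (x : Site d) : ∃ n : ℕ, x ∈ box d n := by
  obtain ⟨n, hn⟩ := exists_nat_ge (∑ i, |(x i : ℝ)|)
  exact ⟨n, mem_box.mpr fun i => (Finset.single_le_sum (f := fun i => |(x i : ℝ)|)
    (fun i _ => abs_nonneg _) (Finset.mem_univ i)).trans hn⟩

theorem tendsto_box : Tendsto (box d) atTop atTop :=
  tendsto_atTop_finset_of_monotone box_mono fun x =>
    let ⟨n, hn⟩ := exists_mem_box x
    ⟨n, hn⟩

theorem shiftedBox_mono (x : Site d) : Monotone fun n : ℕ => shiftedBox n x := fun _ _ h =>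
  Finset.map_subset_map.mpr (box_mono (Nat.cast_le.mpr h))

theorem tendsto_shiftedBox (x : Site d) : Tendsto (fun n : ℕ => shiftedBox n x) atTop atTop :=
  tendsto_atTop_finset_of_monotone (shiftedBox_mono x) fun y =>
    (exists_mem_box (y - x)).imp fun _ hn => Finset.mem_map.mpr ⟨y - x, hn, sub_add_cancel y x⟩

theorem tendsto_evolve_dynamics {F : ℝ → ℝ} (hF : IsDecayFunction d F) {Ψ : Interaction d}
    (hΨ : Ψ.eNormW F < ⊤) (V : Potential d) (t : ℝ) (B : CAR d) :
    Tendsto (fun Λ : Finset (Site d) => evolve ((fermionModel Ψ V).ham Λ) t B) atTop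
      (𝓝 (dynamics Ψ V t B)) := by
  have hsummable (x : Site d) : Summable fun y : Site d => F (len (x - y)) :=
    (Equiv.subLeft x).summable_iff.mpr hF.summable
  have hdense : Dense (⋃ X, ((fermionModel Ψ V).loc X : Set (CAR d))) :=
    dense_iUnion_localAlgebra.mono (Set.iUnion_mono localAlgebra_le_localClosure)
  obtain ⟨C, hC⟩ := cauchySeq_tendsto_of_complete
    ((hasDecay_fermionModel hF hΨ V).cauchySeq_evolve hsummable hdense B t)
  have hbox : Tendsto (fun L : ℝ => finiteDynamics Ψ V L t B) atTop (𝓝 C) := by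
    simp only [finiteDynamics_eq_evolve]
    exact hC.comp tendsto_box
  rwa [dynamics, hbox.limUnder_eq]

theorem tendsto_finiteDynamics {F : ℝ → ℝ} (hF : IsDecayFunction d F) {Ψ : Interaction d}
    (hΨ : Ψ.eNormW F < ⊤) (V : Potential d) (t : ℝ) (B : CAR d) :
    Tendsto (fun L : ℝ => finiteDynamics Ψ V L t B) atTop (𝓝 (dynamics Ψ V t B)) := by
  simp only [finiteDynamics_eq_evolve]
  exact (tendsto_evolve_dynamics hF hΨ V t B).comp tendsto_box

theorem dynamics_zero (Ψ : Interaction d) (V : Potential d) (B : CAR d) :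
    dynamics Ψ V 0 B = B := by
  simp only [dynamics, finiteDynamics_eq_evolve, evolve_zero]
  exact tendsto_const_nhds.limUnder_eq

theorem IsEven.evolve (Ψ : Interaction d) (V : Potential d) (Λ : Finset (Site d)) (t : ℝ)
    {B : CAR d} (hB : IsEven B) : IsEven (evolve ((fermionModel Ψ V).ham Λ) t B) := by
  refine evolve_mem (isClosed_evenSubalgebra d) ?_ hB t
  rw [coe_ham_fermionModel]
  exact add_mem (sum_mem fun Z _ => Ψ.isEven Z) (sum_mem fun x _ => V.isEven x)

theorem IsEven.layer (Ψ : Interaction d) (V : Potential d) (R : ℕ → Finset (Site d)) (t : ℝ)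
    (m : ℕ) {B : CAR d} (hB : IsEven B) (n : ℕ) :
    IsEven ((fermionModel Ψ V).layer R t m B n) := by
  unfold LocalModel.layer
  split_ifs
  · exact hB.evolve Ψ V _ t
  · exact mem_evenSubalgebra.mp (sub_mem (mem_evenSubalgebra.mpr (hB.evolve Ψ V _ t))
      (mem_evenSubalgebra.mpr (hB.evolve Ψ V _ t)))

/-- The coupling `∑ F(|z - y|)`, over `z ∈ Λ_m` and `y ∈ Λ_n \ Λ_{n-1}`, of a box to a shell. -/
def shellSum (d : ℕ) (F : ℝ → ℝ) (m n : ℕ) : ℝ :=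
  kernelSum (fun z y => F (len (z - y))) (box d m) (box d n \ box d ((n : ℝ) - 1))

theorem shellSum_nonneg {F : ℝ → ℝ} (hF : IsDecayFunction d F) (m n : ℕ) : 0 ≤ shellSum d F m n :=
  kernelSum_nonneg (fun z y => (hF.len_pos (z - y)).le) _ _

theorem kernelSum_shiftedBox (F : ℝ → ℝ) (x : Site d) (m : ℕ) {n : ℕ} (hn : 1 ≤ n) :
    kernelSum (fun z y => F (len (z - y))) (shiftedBox m x)
      (shiftedBox n x \ shiftedBox (n - 1) x) = shellSum d F m n := by
  have hshell : shiftedBox n x \ shiftedBox (n - 1) x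
      = (box d n \ box d ((n : ℝ) - 1)).map (addRightEmbedding x) := by
    rw [shiftedBox, shiftedBox, Nat.cast_sub hn, Nat.cast_one]
    simp only [Finset.map_eq_image]
    exact (Finset.image_sdiff _ _ (addRightEmbedding x).injective).symm
  rw [kernelSum, hshell, shiftedBox]
  simp only [shellSum, kernelSum, Finset.sum_map, addRightEmbedding_apply,
    add_sub_add_right_eq_sub]

/-- The bound on the norm of the `n`-th layer of the evolution at time `t` of an observable
localized in a translate of `Λ_m`, relative to the norm of the observable. -/
def layerWeight (d : ℕ) (F : ℝ → ℝ) (α t : ℝ) (m n : ℕ) : ℝ :=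
  if n = m then 1
  else 2 * α * (|t| * Real.exp (4 * convConst d F * α * |t|)) * shellSum d F m n

theorem layerWeight_nonneg {F : ℝ → ℝ} (hF : IsDecayFunction d F) {α : ℝ} (hα : 0 ≤ α) (t : ℝ)
    (m n : ℕ) : 0 ≤ layerWeight d F α t m n := by
  have hshell := shellSum_nonneg hF m n
  unfold layerWeight
  split_ifs <;> positivity

theorem norm_layer_le_layerWeight {F : ℝ → ℝ} (hF : IsDecayFunction d F) {Ψ : Interaction d}
    (hΨ : Ψ.eNormW F < ⊤) (V : Potential d) (t : ℝ) {x : Site d} {m : ℕ} {B : CAR d}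
    (hB : B ∈ localAlgebra (shiftedBox m x)) {n : ℕ} (hn : m ≤ n) :
    ‖(fermionModel Ψ V).layer (fun n => shiftedBox n x) t m B n‖
      ≤ ‖B‖ * layerWeight d F (Ψ.normW F) t m n := by
  have hα := normW_nonneg F Ψ
  have hD := convConst_nonneg d F
  have hshell := shellSum_nonneg hF m n
  rw [layerWeight]
  split_ifs with h
  · rw [h, LocalModel.norm_layer_self, mul_one]
  · have hlt : m < n := lt_of_le_of_ne hn (Ne.symm h)
    refine ((hasDecay_fermionModel hF hΨ V).norm_layer_le (shiftedBox_mono x) t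
      (localAlgebra_le_localClosure _ hB) hlt).trans ?_
    rw [kernelSum_shiftedBox F x m (by lia), mul_assoc]
    gcongr
    norm_num

end Dynamics

section Trees

theorem image_mem_trees {p : ℕ → ℕ} {k : ℕ} (hp : ∀ j, 1 ≤ j → j ≤ k → p j < j) :
    (Finset.Icc 1 k).image (fun j => s(p j, j)) ∈ trees k := by
  induction k with
  | zero => exact Finset.mem_singleton_self ∅
  | succ k ih =>
    rw [trees, Finset.mem_image]
    refine ⟨(p (k + 1), (Finset.Icc 1 k).image fun j => s(p j, j)), Finset.mem_product.mpr
      ⟨Finset.mem_range.mpr (hp (k + 1) (by lia) le_rfl), ih fun j h1 h2 => hp j h1 (by lia)⟩, ?_⟩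
    rw [← Finset.insert_Icc_right_eq_Icc_add_one (by lia), Finset.image_insert]

theorem parent_image {p : ℕ → ℕ} {k : ℕ} (hp : ∀ j, 1 ≤ j → j ≤ k → p j < j) {j : ℕ} (h1 : 1 ≤ j)
    (hk : j ≤ k) : parent ((Finset.Icc 1 k).image fun j => s(p j, j)) j = p j := by
  suffices {i | i < j ∧ s(i, j) ∈ (Finset.Icc 1 k).image fun j => s(p j, j)} = {p j} by
    rw [parent, this, csInf_singleton]
  ext i
  simp only [Set.mem_ofPred_eq, Finset.mem_image, Finset.mem_Icc, Sym2.eq_iff,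
    Set.mem_singleton_iff]
  constructor
  · rintro ⟨hij, l, ⟨h1l, hlk⟩, ⟨h, rfl⟩ | ⟨h, rfl⟩⟩
    · exact h.symm
    · have := hp l h1l hlk
      lia
  · rintro rfl
    exact ⟨hp j h1 hk, j, ⟨h1, hk⟩, Or.inl ⟨rfl, rfl⟩⟩

variable {d : ℕ}

theorem overlap_nonneg (k : ℕ) (T : Finset (Sym2 ℕ)) (n : ℕ → ℕ) (x : ℕ → Site d) :
    0 ≤ overlap k T n x :=
  Finset.prod_nonneg fun j _ => by split_ifs <;> norm_num

theorem overlap_le_one (k : ℕ) (T : Finset (Sym2 ℕ)) (n : ℕ → ℕ) (x : ℕ → Site d) :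
    overlap k T n x ≤ 1 :=
  Finset.prod_le_one (fun j _ => by split_ifs <;> norm_num) fun j _ => by split_ifs <;> norm_num

theorem one_le_sum_overlap {k : ℕ} {n : ℕ → ℕ} {x : ℕ → Site d}
    (h : ∀ j, 1 ≤ j → j ≤ k → ∃ i < j,
      (shiftedBox (n j) (x j) ∩ shiftedBox (n i) (x i)).Nonempty) :
    1 ≤ ∑ T ∈ trees k, overlap k T n x := by
  choose! p hp hoverlap using h
  calc 1 = overlap k ((Finset.Icc 1 k).image fun j => s(p j, j)) n x := by
        refine (Finset.prod_eq_one fun j hj => ?_).symm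
        obtain ⟨h1, hk⟩ := Finset.mem_Icc.mp hj
        rw [parent_image hp h1 hk, if_pos (hoverlap j h1 hk)]
    _ ≤ ∑ T ∈ trees k, overlap k T n x :=
        Finset.single_le_sum (fun T _ => overlap_nonneg k T n x) (image_mem_trees hp)

end Trees

section MultiIndices

open Classical in
/-- The multi-indices `ν` with `ν j ∈ S j` for `j < k` and `ν j = m j` for `j ≥ k`. -/
def multiIndices (m : ℕ → ℕ) (S : ℕ → Finset ℕ) : ℕ → Finset (ℕ → ℕ)
  | 0 => {m}
  | k + 1 => Finset.image₂ (fun n ν => Function.update ν k n) (S k) (multiIndices m S k)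

variable {m : ℕ → ℕ} {S : ℕ → Finset ℕ}

theorem mem_multiIndices {k : ℕ} {ν : ℕ → ℕ} :
    ν ∈ multiIndices m S k ↔ (∀ j < k, ν j ∈ S j) ∧ ∀ j, k ≤ j → ν j = m j := by
  induction k generalizing ν with
  | zero => simp [multiIndices, funext_iff]
  | succ k ih =>
    simp only [multiIndices, Finset.mem_image₂, ih]
    constructor
    · rintro ⟨n, hn, μ, ⟨hμS, hμm⟩, rfl⟩
      refine ⟨fun j hj => ?_, fun j hj => ?_⟩
      · rcases eq_or_ne j k with rfl | hne
        · rwa [Function.update_self]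
        · rw [Function.update_of_ne hne]
          exact hμS j (by lia)
      · rw [Function.update_of_ne (by lia)]
        exact hμm j (by lia)
    · rintro ⟨hνS, hνm⟩
      refine ⟨ν k, hνS k (by lia), Function.update ν k (m k), ⟨fun j hj => ?_, fun j hj => ?_⟩, ?_⟩
      · rw [Function.update_of_ne hj.ne]
        exact hνS j (by lia)
      · rcases eq_or_ne j k with rfl | hne
        · rw [Function.update_self]
        · rw [Function.update_of_ne hne]
          exact hνm j (by lia)
      · rw [Function.update_idem, Function.update_eq_self]

open Classical in
theorem sum_multiIndices_succ {E : Type*} [AddCommMonoid E] (m : ℕ → ℕ) (S : ℕ → Finset ℕ) (k : ℕ)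
    (f : (ℕ → ℕ) → E) :
    ∑ ν ∈ multiIndices m S (k + 1), f ν
      = ∑ n ∈ S k, ∑ ν ∈ multiIndices m S k, f (Function.update ν k n) := by
  rw [multiIndices, ← Finset.image_uncurry_product, Finset.sum_image, Finset.sum_product]
  · rfl
  · rintro ⟨n, μ⟩ hμ ⟨n', μ'⟩ hμ' h
    have hcoord (j : ℕ) : Function.update μ k n j = Function.update μ' k n' j := congrFun h j
    refine Prod.ext (by simpa using hcoord k) (funext fun j => ?_)
    rcases eq_or_ne j k with rfl | hne
    · exact ((mem_multiIndices.mp (Finset.mem_product.mp hμ).2).2 j le_rfl).trans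
        ((mem_multiIndices.mp (Finset.mem_product.mp hμ').2).2 j le_rfl).symm
    · simpa only [Function.update_of_ne hne] using hcoord j

end MultiIndices

section MultiCommutators

section Ring

variable {A : Type*} [Ring A]

theorem multiCommutator_succ (B : ℕ → A) (k : ℕ) :
    multiCommutator B (k + 1) = ⁅B (k + 1), multiCommutator B k⁆ :=
  rfl

theorem multiCommutator_congr {B C : ℕ → A} {k : ℕ} (h : ∀ j ≤ k, B j = C j) :
    multiCommutator B k = multiCommutator C k := by
  induction k with
  | zero => exact h 0 le_rfl
  | succ k ih =>
    rw [multiCommutator_succ, multiCommutator_succ, ih fun j hj => h j (by lia), h (k + 1) le_rfl]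

theorem multiCommutator_eq_zero_of_le {B : ℕ → A} {j k : ℕ} (hjk : j ≤ k)
    (h : multiCommutator B j = 0) : multiCommutator B k = 0 := by
  induction k, hjk using Nat.le_induction with
  | base => exact h
  | succ k _ ih => rw [multiCommutator_succ, ih, lie_zero]

theorem multiCommutator_sum (m : ℕ → ℕ) (S : ℕ → Finset ℕ) (b : ℕ → ℕ → A) (k : ℕ) :
    multiCommutator (fun j => ∑ n ∈ S j, b j n) k
      = ∑ ν ∈ multiIndices m S (k + 1), multiCommutator (fun j => b j (ν j)) k := by
  induction k with
  | zero =>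
    rw [sum_multiIndices_succ]
    simp only [multiCommutator, multiIndices, Finset.sum_singleton, Function.update_self]
  | succ k ih =>
    have hupdate (n : ℕ) (ν : ℕ → ℕ) :
        multiCommutator (fun j => b j (Function.update ν (k + 1) n j)) (k + 1)
          = ⁅b (k + 1) n, multiCommutator (fun j => b j (ν j)) k⁆ := by
      rw [multiCommutator_succ, Function.update_self, multiCommutator_congr fun j hj => by
        rw [Function.update_of_ne (by lia : j ≠ k + 1)]]
    simp only [sum_multiIndices_succ m S (k + 1), hupdate]
    rw [multiCommutator_succ, ih, sum_lie_sum]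

end Ring

section NormedRing

variable {A : Type*} [NormedRing A]

theorem tendsto_multiCommutator {ι : Type*} {l : Filter ι} {B : ι → ℕ → A} {C : ℕ → A} {k : ℕ}
    (h : ∀ j ≤ k, Tendsto (fun i => B i j) l (𝓝 (C j))) :
    Tendsto (fun i => multiCommutator (B i) k) l (𝓝 (multiCommutator C k)) := by
  induction k with
  | zero => exact h 0 le_rfl
  | succ k ih =>
    have hinner := ih fun j hj => h j (by lia)
    have houter := h (k + 1) le_rfl
    exact (houter.mul hinner).sub (hinner.mul houter)

theorem norm_multiCommutator_le (B : ℕ → A) (k : ℕ) :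
    ‖multiCommutator B k‖ ≤ 2 ^ k * ∏ j ∈ Finset.range (k + 1), ‖B j‖ := by
  induction k with
  | zero => simp [multiCommutator]
  | succ k ih =>
    calc ‖multiCommutator B (k + 1)‖
        ≤ 2 * ‖B (k + 1)‖ * ‖multiCommutator B k‖ := by
          rw [multiCommutator_succ]
          exact norm_lie_le _ _
      _ ≤ 2 * ‖B (k + 1)‖ * (2 ^ k * ∏ j ∈ Finset.range (k + 1), ‖B j‖) := by gcongr
      _ = 2 ^ (k + 1) * ∏ j ∈ Finset.range (k + 1 + 1), ‖B j‖ := by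
          rw [Finset.prod_range_succ _ (k + 1)]
          ring

end NormedRing

variable {d : ℕ}

theorem multiCommutator_mem_localClosure {X : ℕ → Finset (Site d)} {B : ℕ → CAR d} {k : ℕ}
    (hB : ∀ j ≤ k, B j ∈ localClosure (X j)) :
    multiCommutator B k ∈ localClosure ((Finset.range (k + 1)).biUnion X) := by
  induction k with
  | zero => simpa [multiCommutator] using hB 0 le_rfl
  | succ k ih =>
    have hinner : multiCommutator B k ∈ localClosure ((Finset.range (k + 1 + 1)).biUnion X) :=
      localClosure_mono (Finset.biUnion_subset_biUnion_of_subset_left X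
        (Finset.range_mono (Nat.le_succ _))) (ih fun j hj => hB j (by lia))
    have houter : B (k + 1) ∈ localClosure ((Finset.range (k + 1 + 1)).biUnion X) :=
      localClosure_mono (Finset.subset_biUnion_of_mem X (Finset.self_mem_range_succ _))
        (hB (k + 1) le_rfl)
    exact sub_mem (mul_mem houter hinner) (mul_mem hinner houter)

theorem multiCommutator_eq_zero_of_disjoint {X : ℕ → Finset (Site d)} {B : ℕ → CAR d} {k : ℕ}
    (hB : ∀ j ≤ k, B j ∈ localClosure (X j)) {j : ℕ} (h1 : 1 ≤ j) (hjk : j ≤ k)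
    (he : IsEven (B j)) (hX : ∀ i < j, Disjoint (X j) (X i)) : multiCommutator B k = 0 := by
  refine multiCommutator_eq_zero_of_le hjk ?_
  obtain ⟨j, rfl⟩ := Nat.exists_eq_add_of_le' h1
  have hdisj : Disjoint (X (j + 1)) ((Finset.range (j + 1)).biUnion X) :=
    Finset.disjoint_biUnion_right _ _ _ |>.mpr fun i hi => hX i (Finset.mem_range.mp hi)
  exact (he.commute hdisj (hB (j + 1) hjk)
    (multiCommutator_mem_localClosure fun i hi => hB i (by lia))).lie_eq

theorem norm_multiCommutator_le_overlap {k : ℕ} {n : ℕ → ℕ} {x : ℕ → Site d} {B : ℕ → CAR d}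
    (hB : ∀ j ≤ k, B j ∈ localClosure (shiftedBox (n j) (x j)))
    (he : ∀ j, 1 ≤ j → j ≤ k → IsEven (B j)) :
    ‖multiCommutator B k‖ ≤ 2 ^ k * (∏ j ∈ Finset.range (k + 1), ‖B j‖) *
      ∑ T ∈ trees k, overlap k T n x := by
  have hnonneg : 0 ≤ 2 ^ k * ∏ j ∈ Finset.range (k + 1), ‖B j‖ := by positivity
  by_cases h : ∀ j, 1 ≤ j → j ≤ k → ∃ i < j,
      (shiftedBox (n j) (x j) ∩ shiftedBox (n i) (x i)).Nonempty
  · exact (norm_multiCommutator_le B k).trans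
      (le_mul_of_one_le_right hnonneg (one_le_sum_overlap h))
  · push Not at h
    obtain ⟨j, h1, hjk, hj⟩ := h
    rw [multiCommutator_eq_zero_of_disjoint hB h1 hjk (he j h1 hjk) fun i hi =>
      Finset.disjoint_iff_inter_eq_empty.mpr (hj i hi), norm_zero]
    exact mul_nonneg hnonneg (Finset.sum_nonneg fun T _ => overlap_nonneg k T n x)

theorem norm_multiCommutator_sum_le {k : ℕ} (m : ℕ → ℕ) {S : ℕ → Finset ℕ} {x : ℕ → Site d}
    {b : ℕ → ℕ → CAR d} {c : ℕ → ℝ} {w : ℕ → ℕ → ℝ}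
    (hloc : ∀ j ≤ k, ∀ n ∈ S j, b j n ∈ localClosure (shiftedBox n (x j)))
    (heven : ∀ j, 1 ≤ j → j ≤ k → ∀ n ∈ S j, IsEven (b j n))
    (hnorm : ∀ j ≤ k, ∀ n ∈ S j, ‖b j n‖ ≤ c j * w j n) :
    ‖multiCommutator (fun j => ∑ n ∈ S j, b j n) k‖
      ≤ 2 ^ k * (∏ j ∈ Finset.range (k + 1), c j) * ∑ T ∈ trees k,
        ∑ ν ∈ multiIndices m S (k + 1),
          overlap k T ν x * ∏ j ∈ Finset.range (k + 1), w j (ν j) := by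
  have hterm : ∀ ν ∈ multiIndices m S (k + 1), ‖multiCommutator (fun j => b j (ν j)) k‖
      ≤ 2 ^ k * (∏ j ∈ Finset.range (k + 1), c j * w j (ν j)) * ∑ T ∈ trees k, overlap k T ν x := by
    intro ν hν
    have hνS (j : ℕ) (hj : j ≤ k) : ν j ∈ S j := (mem_multiIndices.mp hν).1 j (by lia)
    refine (norm_multiCommutator_le_overlap (fun j hj => hloc j hj _ (hνS j hj))
      fun j h1 hj => heven j h1 hj _ (hνS j hj)).trans ?_
    gcongr with j hj
    · exact Finset.sum_nonneg fun T _ => overlap_nonneg k T ν x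
    · have hjk := Finset.mem_range_succ_iff.mp hj
      exact hnorm j hjk (ν j) (hνS j hjk)
  rw [multiCommutator_sum m, Finset.sum_comm (s := trees k), Finset.mul_sum]
  refine (norm_sum_le _ _).trans (Finset.sum_le_sum fun ν hν => (hterm ν hν).trans_eq ?_)
  rw [Finset.prod_mul_distrib, ← Finset.sum_mul]
  ring

end MultiCommutators

section Summation

theorem summable_sum_of_pairwise_disjoint {ι σ E : Type*} [NormedAddCommGroup E] [CompleteSpace E]
    {f : σ → E} (hf : Summable f) {s : ι → Finset σ} (hs : Pairwise (Function.onFun Disjoint s)) :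
    Summable fun i => ∑ y ∈ s i, f y := by
  have hinj : Function.Injective fun p : Σ i, s i => (p.2 : σ) := by
    rintro ⟨i, y, hy⟩ ⟨j, z, hz⟩ (rfl : y = z)
    obtain rfl : i = j := by_contra fun hij => Finset.disjoint_left.mp (hs hij) hy hz
    rfl
  exact (hf.comp_injective hinj).sigma.congr fun i => Finset.tsum_subtype (s i) f

theorem summable_prod_apply {ι : Type*} [Fintype ι] {κ : ι → Type*} {f : ∀ i, κ i → ℝ}
    (hf : ∀ i, Summable (f i)) (hf0 : ∀ i n, 0 ≤ f i n) :
    Summable fun n : ∀ i, κ i => ∏ i, f i (n i) := by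
  classical
  have hprod_nonneg (n : ∀ i, κ i) : 0 ≤ ∏ i, f i (n i) := Finset.prod_nonneg fun i _ => hf0 i _
  refine summable_of_sum_le (c := ∏ i, ∑' n, f i n) hprod_nonneg fun u => ?_
  calc ∑ n ∈ u, ∏ i, f i (n i)
      ≤ ∑ n ∈ Fintype.piFinset fun i => u.image fun n => n i, ∏ i, f i (n i) :=
        Finset.sum_le_sum_of_subset_of_nonneg (fun n hn => Fintype.mem_piFinset.mpr fun i =>
          Finset.mem_image_of_mem (fun n => n i) hn) fun n _ _ => hprod_nonneg n
    _ = ∏ i, ∑ n ∈ u.image fun n => n i, f i n := (Finset.prod_univ_sum _ _).symm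
    _ ≤ ∏ i, ∑' n, f i n := Finset.prod_le_prod (fun i _ => Finset.sum_nonneg fun n _ => hf0 i n)
        fun i _ => (hf i).sum_le_tsum _ fun n _ => hf0 i n

theorem sum_le_sum_tsum {ι β : Type*} [Fintype ι] {κ : ι → Type*} {e : ∀ i, κ i → β} {g : β → ℝ}
    (hg : ∀ b, 0 ≤ g b) (hsum : ∀ i, Summable fun n => g (e i n)) {s : Finset β}
    (hs : ∀ b ∈ s, g b ≠ 0 → ∃ i n, e i n = b) :
    ∑ b ∈ s, g b ≤ ∑ i, ∑' n, g (e i n) := by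
  classical
  have hsigma : Summable fun p : Σ i, κ i => g (e p.1 p.2) :=
    (summable_sigma_of_nonneg fun p => hg _).mpr ⟨hsum, Summable.of_finite⟩
  obtain ⟨u, -, hu⟩ := Finset.subset_set_image_iff.mp
    (show ↑{b ∈ s | g b ≠ 0} ⊆ (fun p : Σ i, κ i => e p.1 p.2) '' Set.univ by
      intro b hb
      obtain ⟨hbs, hb0⟩ := Finset.mem_filter.mp hb
      obtain ⟨i, n, rfl⟩ := hs b hbs hb0
      exact ⟨⟨i, n⟩, trivial, rfl⟩)
  calc ∑ b ∈ s, g b = ∑ b ∈ u.image fun p => e p.1 p.2, g b := by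
        rw [hu, Finset.sum_filter_ne_zero]
    _ ≤ ∑ p ∈ u, g (e p.1 p.2) := Finset.sum_image_le_of_nonneg fun b _ => hg b
    _ ≤ ∑' p : Σ i, κ i, g (e p.1 p.2) := hsigma.sum_le_tsum _ fun p _ => hg _
    _ = ∑ i, ∑' n, g (e i n) := by rw [hsigma.tsum_sigma, tsum_fintype]

end Summation

section IncreasingMaps

variable {l k : ℕ}

theorem IncMaps.injective_coe (π : IncMaps l k) :
    Function.Injective fun i => (π.1 i : ℕ) :=
  Subtype.val_injective.comp π.2.injective

theorem exists_incMaps_range_eq {J : Finset ℕ} (hJ : J ⊆ Finset.Icc 1 k) (hne : J.Nonempty) :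
    ∃ l ∈ Finset.Icc 1 k, ∃ π : IncMaps l k, Set.range (fun i => (π.1 i : ℕ)) = J := by
  have hle : J.card ≤ k := by simpa using Finset.card_le_card hJ
  have hpos : 0 < J.card := hne.card_pos
  have hcard : (Finset.Icc (k + 1 - J.card) k).card = J.card := by
    rw [Nat.card_Icc]
    lia
  let e : Finset.Icc (k + 1 - J.card) k ≃o J :=
    ((Finset.Icc (k + 1 - J.card) k).orderIsoOfFin hcard).symm.trans (J.orderIsoOfFin rfl)
  refine ⟨k + 1 - J.card, Finset.mem_Icc.mpr (by lia),
    ⟨fun i => ⟨e i, hJ (e i).2⟩, fun _ _ h => e.strictMono h⟩, ?_⟩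
  exact (e.surjective.range_comp (Subtype.val : J → ℕ)).trans Subtype.range_coe

/-- The multi-index with the entries `n` on the range of the increasing map `π` and the entries of
`m` elsewhere. -/
def IncMaps.multiIndex (π : IncMaps l k) (m : ℕ → ℕ) (n : Finset.Icc l k → ℕ) : ℕ → ℕ :=
  Function.extend (fun i => (π.1 i : ℕ)) n m

theorem IncMaps.multiIndex_apply (π : IncMaps l k) (m : ℕ → ℕ) (n : Finset.Icc l k → ℕ)
    (i : Finset.Icc l k) : IncMaps.multiIndex π m n (π.1 i) = n i :=
  (IncMaps.injective_coe π).extend_apply n m i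

theorem IncMaps.multiIndex_of_notMem (π : IncMaps l k) (m : ℕ → ℕ) (n : Finset.Icc l k → ℕ) {j : ℕ}
    (hj : j ∉ Set.range fun i => (π.1 i : ℕ)) : IncMaps.multiIndex π m n j = m j :=
  Function.extend_apply' n m j hj

theorem exists_multiIndex_eq {m ν : ℕ → ℕ} (hle : m ≤ ν) (hne : ν ≠ m)
    (hν : ∀ j, ν j ≠ m j → j ∈ Finset.Icc 1 k) :
    ∃ l ∈ Finset.Icc 1 k, ∃ (π : IncMaps l k)
      (n : (i : Finset.Icc l k) → {n : ℕ // m (π.1 i) + 1 ≤ n}),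
      IncMaps.multiIndex π m (fun i => n i) = ν := by
  obtain ⟨j, hj⟩ := Function.ne_iff.mp hne
  obtain ⟨l, hl, π, hπ⟩ := exists_incMaps_range_eq
    (Finset.filter_subset (fun j => ν j ≠ m j) (Finset.Icc 1 k))
    ⟨j, Finset.mem_filter.mpr ⟨hν j hj, hj⟩⟩
  have hrange (j : ℕ) : j ∈ Set.range (fun i => (π.1 i : ℕ)) ↔ ν j ≠ m j := by
    rw [hπ, Finset.mem_coe, Finset.mem_filter, and_iff_right_of_imp (hν j)]
  refine ⟨l, hl, π, fun i => ⟨ν (π.1 i), ?_⟩, funext fun j => ?_⟩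
  · exact lt_of_le_of_ne (hle _) ((hrange _).mp ⟨i, rfl⟩).symm
  · by_cases h : j ∈ Set.range fun i => (π.1 i : ℕ)
    · obtain ⟨i, rfl⟩ := h
      exact IncMaps.multiIndex_apply π m _ i
    · rw [IncMaps.multiIndex_of_notMem π m _ h]
      exact (not_not.mp fun hne => h ((hrange j).mpr hne)).symm

end IncreasingMaps

section Remainder

variable {d : ℕ} {F : ℝ → ℝ}

theorem summable_shellSum (hF : IsDecayFunction d F) (m : ℕ) : Summable (shellSum d F m) := by
  have hdisj : Pairwise (Function.onFun Disjoint
      fun n : ℕ => box d n \ box d ((n : ℝ) - 1)) := by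
    refine (pairwise_disjoint_on _).mpr fun n n' h => ?_
    have hn : (n : ℝ) ≤ (n' : ℝ) - 1 := by
      rw [le_sub_iff_add_le]
      exact_mod_cast h
    exact Finset.disjoint_of_subset_left (Finset.sdiff_subset.trans (box_mono hn))
      Finset.disjoint_sdiff
  exact summable_sum fun z _ =>
    summable_sum_of_pairwise_disjoint ((Equiv.subLeft z).summable_iff.mpr hF.summable) hdisj

theorem summable_layerWeight (hF : IsDecayFunction d F) (α t : ℝ) (m : ℕ) :
    Summable (layerWeight d F α t m) :=
  (((summable_shellSum hF m).mul_left _).update m 1).congr fun _ => Function.update_apply ..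

theorem layerWeight_self (d : ℕ) (F : ℝ → ℝ) (α t : ℝ) (m : ℕ) : layerWeight d F α t m m = 1 :=
  if_pos rfl

theorem layerWeight_zero (d : ℕ) (F : ℝ → ℝ) (α : ℝ) {m n : ℕ} (h : n ≠ m) :
    layerWeight d F α 0 m n = 0 := by
  rw [layerWeight, if_neg h, abs_zero, zero_mul, mul_zero, zero_mul]

/-- The contribution of the tree `T` to the bound on the multi-commutator of the layers selected
by the multi-index `ν`. -/
def layerTerm (F : ℝ → ℝ) (k : ℕ) (T : Finset (Sym2 ℕ)) (m : ℕ → ℕ) (s : ℕ → ℝ) (x : ℕ → Site d)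
    (α : ℝ) (ν : ℕ → ℕ) : ℝ :=
  overlap k T ν x * ∏ j ∈ Finset.range (k + 1), layerWeight d F α (s j) (m j) (ν j)

variable {l k : ℕ} {α : ℝ} (T : Finset (Sym2 ℕ)) (m : ℕ → ℕ) (s : ℕ → ℝ) (x : ℕ → Site d)

theorem layerTerm_nonneg (hF : IsDecayFunction d F) (hα : 0 ≤ α) (ν : ℕ → ℕ) :
    0 ≤ layerTerm F k T m s x α ν :=
  mul_nonneg (overlap_nonneg k T ν x)
    (Finset.prod_nonneg fun _ _ => layerWeight_nonneg hF hα _ _ _)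

theorem layerTerm_self : layerTerm F k T m s x α m = overlap k T m x := by
  rw [layerTerm, Finset.prod_eq_one fun j _ => layerWeight_self d F α (s j) (m j), mul_one]

theorem prod_layerWeight_multiIndex (π : IncMaps l k) (n : Finset.Icc l k → ℕ) :
    ∏ j ∈ Finset.range (k + 1), layerWeight d F α (s j) (m j) (IncMaps.multiIndex π m n j)
      = ∏ i, layerWeight d F α (s (π.1 i)) (m (π.1 i)) (n i) := by
  refine (Finset.prod_of_injOn (fun i => (π.1 i : ℕ)) (IncMaps.injective_coe π).injOn
    (fun i _ => ?_) (fun j _ hj => ?_) fun i _ => ?_).symm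
  · exact Finset.mem_coe.mpr (Finset.mem_range_succ_iff.mpr (Finset.mem_Icc.mp (π.1 i).2).2)
  · rw [Finset.coe_univ, Set.image_univ] at hj
    rw [IncMaps.multiIndex_of_notMem π m n hj, layerWeight_self]
  · rw [IncMaps.multiIndex_apply]

theorem summable_layerTerm_multiIndex (hF : IsDecayFunction d F) (hα : 0 ≤ α) (π : IncMaps l k) :
    Summable fun n : (i : Finset.Icc l k) → {n : ℕ // m (π.1 i) + 1 ≤ n} =>
      layerTerm F k T m s x α (IncMaps.multiIndex π m fun i => n i) := by
  refine (summable_prod_apply (fun i : Finset.Icc l k =>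
    (summable_layerWeight hF α (s (π.1 i)) (m (π.1 i))).comp_injective
      (Subtype.val_injective (p := fun n => m (π.1 i) + 1 ≤ n)))
    fun i _ => layerWeight_nonneg hF hα _ _ _).of_nonneg_of_le
      (fun n => layerTerm_nonneg T m s x hF hα _) fun n => ?_
  rw [layerTerm, prod_layerWeight_multiIndex]
  exact mul_le_of_le_one_left (Finset.prod_nonneg fun _ _ => layerWeight_nonneg hF hα _ _ _)
    (overlap_le_one k T _ x)

theorem layerTerm_multiIndex (hl : l ≤ k) (π : IncMaps l k)
    (n : (i : Finset.Icc l k) → {n : ℕ // m (π.1 i) + 1 ≤ n}) :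
    layerTerm F k T m s x α (IncMaps.multiIndex π m fun i => n i)
      = (2 * α) ^ (k - l + 1) *
        ((∏ i : Finset.Icc l k, |s (π.1 i)| * Real.exp (4 * convConst d F * α * |s (π.1 i)|)) *
        ∑ z ∈ Fintype.piFinset fun i : Finset.Icc l k => box d (m (π.1 i)),
          ∑ y ∈ Fintype.piFinset fun i : Finset.Icc l k =>
              box d ((n i : ℕ) : ℝ) \ box d (((n i : ℕ) : ℝ) - 1),
            overlap k T (IncMaps.multiIndex π m fun i => n i) x *
              ∏ i : Finset.Icc l k, F (len (z i - y i))) := by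
  have hweight (i : Finset.Icc l k) : layerWeight d F α (s (π.1 i)) (m (π.1 i)) (n i)
      = 2 * α * (|s (π.1 i)| * Real.exp (4 * convConst d F * α * |s (π.1 i)|))
        * shellSum d F (m (π.1 i)) (n i) :=
    if_neg (Nat.ne_of_gt (n i).2)
  have hshell : ∏ i : Finset.Icc l k, shellSum d F (m (π.1 i)) (n i)
      = ∑ z ∈ Fintype.piFinset fun i : Finset.Icc l k => box d (m (π.1 i)),
          ∑ y ∈ Fintype.piFinset fun i : Finset.Icc l k =>
              box d ((n i : ℕ) : ℝ) \ box d (((n i : ℕ) : ℝ) - 1),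
            ∏ i : Finset.Icc l k, F (len (z i - y i)) := by
    simp only [shellSum, kernelSum, Finset.prod_univ_sum]
  rw [layerTerm, prod_layerWeight_multiIndex, Finset.prod_congr rfl fun i _ => hweight i,
    Finset.prod_mul_distrib, Finset.prod_mul_distrib, hshell, Finset.prod_const, Finset.card_univ,
    Fintype.card_coe, Nat.card_Icc, Nat.sub_add_comm hl]
  simp only [← Finset.mul_sum]
  ring

theorem remainder_eq_sum_tsum_layerTerm :
    remainder F k T m s x α = ∑ p : Σ l : Finset.Icc 1 k, IncMaps l k,
      ∑' n : (i : Finset.Icc (p.1 : ℕ) k) → {n : ℕ // m (p.2.1 i) + 1 ≤ n},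
        layerTerm F k T m s x α (IncMaps.multiIndex p.2 m fun i => n i) := by
  rw [remainder, Fintype.sum_sigma, ← Finset.sum_coe_sort]
  refine Finset.sum_congr rfl fun l _ => (Finset.mul_sum _ _ _).trans
    (Finset.sum_congr rfl fun π _ => ?_)
  rw [tsum_congr fun n => layerTerm_multiIndex T m s x (Finset.mem_Icc.mp l.2).2 π n,
    tsum_mul_left, tsum_mul_left]
  rfl

theorem sum_layerTerm_le (hF : IsDecayFunction d F) (hα : 0 ≤ α) (hs : s 0 = 0) {N : ℕ}
    (hN : ∀ j ≤ k, m j ≤ N) :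
    ∑ ν ∈ multiIndices m (fun j => Finset.Icc (m j) N) (k + 1), layerTerm F k T m s x α ν
      ≤ overlap k T m x + remainder F k T m s x α := by
  classical
  have hm : m ∈ multiIndices m (fun j => Finset.Icc (m j) N) (k + 1) :=
    mem_multiIndices.mpr ⟨fun j hj => Finset.left_mem_Icc.mpr (hN j (by lia)), fun _ _ => rfl⟩
  rw [← Finset.add_sum_erase _ _ hm, layerTerm_self, remainder_eq_sum_tsum_layerTerm]
  gcongr
  refine sum_le_sum_tsum (ι := Σ l : Finset.Icc 1 k, IncMaps l k)
    (κ := fun p => (i : Finset.Icc (p.1 : ℕ) k) → {n : ℕ // m (p.2.1 i) + 1 ≤ n})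
    (e := fun p n => IncMaps.multiIndex p.2 m fun i => n i)
    (layerTerm_nonneg T m s x hF hα)
    (fun p => summable_layerTerm_multiIndex T m s x hF hα p.2) fun ν hν hν0 => ?_
  obtain ⟨hνm, hν⟩ := Finset.mem_erase.mp hν
  obtain ⟨hνS, hνk⟩ := mem_multiIndices.mp hν
  have hle : m ≤ ν := fun j => by
    rcases lt_or_ge j (k + 1) with h | h
    · exact (Finset.mem_Icc.mp (hνS j h)).1
    · exact (hνk j h).ge
  have hzero : ν 0 = m 0 := by
    by_contra h
    refine hν0 (mul_eq_zero_of_right _ (Finset.prod_eq_zero (Finset.mem_range.mpr k.succ_pos) ?_))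
    rw [hs, layerWeight_zero d F α h]
  obtain ⟨l, hl, π, n, hn⟩ := exists_multiIndex_eq (k := k) hle hνm fun j hj =>
    Finset.mem_Icc.mpr ⟨Nat.one_le_iff_ne_zero.mpr fun h => hj (h ▸ hzero),
      not_lt.mp fun h => hj (hνk j h)⟩
  exact ⟨⟨⟨l, hl⟩, π⟩, n, hn⟩


variable {s} in
theorem remainder_congr {s' : ℕ → ℝ} (h : ∀ j, 1 ≤ j → j ≤ k → s j = s' j) :
    remainder F k T m s x α = remainder F k T m s' x α := by
  have hπ (l : ℕ) (π : IncMaps l k) (i : Finset.Icc l k) : s (π.1 i) = s' (π.1 i) :=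
    h _ (Finset.mem_Icc.mp (π.1 i).2).1 (Finset.mem_Icc.mp (π.1 i).2).2
  simp only [remainder, hπ]

end Remainder

section Bounds

variable {d : ℕ} {F : ℝ → ℝ}

theorem norm_multiCommutator_evolve_le (hF : IsDecayFunction d F) {Ψ : Interaction d}
    (hΨ : Ψ.eNormW F < ⊤) (V : Potential d) {k : ℕ} {m : ℕ → ℕ} {s : ℕ → ℝ} {x : ℕ → Site d}
    {B : ℕ → CAR d} (hs : s 0 = 0)
    (hB : ∀ j ≤ k, B j ∈ localAlgebra (shiftedBox (m j) (x j)))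
    (he : ∀ j, 1 ≤ j → j ≤ k → IsEven (B j)) {N : ℕ} (hN : ∀ j ≤ k, m j ≤ N) :
    ‖multiCommutator
        (fun j => evolve ((fermionModel Ψ V).ham (shiftedBox N (x j))) (s j) (B j)) k‖
      ≤ 2 ^ k * (∏ j ∈ Finset.range (k + 1), ‖B j‖) *
        ∑ T ∈ trees k, (overlap k T m x + remainder F k T m s x (Ψ.normW F)) := by
  rw [multiCommutator_congr fun j hj => ((fermionModel Ψ V).sum_layer
    (fun n => shiftedBox n (x j)) (s j) (B j) (hN j hj)).symm]
  refine (norm_multiCommutator_sum_le m (c := fun j => ‖B j‖)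
    (w := fun j n => layerWeight d F (Ψ.normW F) (s j) (m j) n)
    (fun j hj n hn => (fermionModel Ψ V).layer_mem (shiftedBox_mono (x j)) (s j)
      (localAlgebra_le_localClosure _ (hB j hj)) (Finset.mem_Icc.mp hn).1)
    (fun j h1 hj n _ => (he j h1 hj).layer Ψ V _ (s j) (m j) n)
    fun j hj n hn => norm_layer_le_layerWeight hF hΨ V (s j) (hB j hj)
      (Finset.mem_Icc.mp hn).1).trans ?_
  gcongr with T
  exact sum_layerTerm_le T m s x hF (normW_nonneg F Ψ) hs hN

theorem norm_multiCommutator_dynamics_le (hF : IsDecayFunction d F) {Ψ : Interaction d}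
    (hΨ : Ψ.eNormW F < ⊤) (V : Potential d) {k : ℕ} {m : ℕ → ℕ} {s : ℕ → ℝ} {x : ℕ → Site d}
    {B : ℕ → CAR d} (hs : s 0 = 0)
    (hB : ∀ j ≤ k, B j ∈ localAlgebra (shiftedBox (m j) (x j)))
    (he : ∀ j, 1 ≤ j → j ≤ k → IsEven (B j)) :
    ‖multiCommutator (fun j => dynamics Ψ V (s j) (B j)) k‖
      ≤ 2 ^ k * (∏ j ∈ Finset.range (k + 1), ‖B j‖) *
        ∑ T ∈ trees k, (overlap k T m x + remainder F k T m s x (Ψ.normW F)) := by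
  refine le_of_tendsto (tendsto_multiCommutator fun j _ =>
    (tendsto_evolve_dynamics hF hΨ V (s j) (B j)).comp (tendsto_shiftedBox (x j))).norm ?_
  filter_upwards [eventually_ge_atTop (∑ j ∈ Finset.range (k + 1), m j)] with N hN
  exact norm_multiCommutator_evolve_le hF hΨ V hs hB he fun j hj =>
    (Finset.single_le_sum_of_canonicallyOrdered (Finset.mem_range_succ_iff.mpr hj)).trans hN

theorem norm_translation (v : Site d) (B : CAR d) : ‖translation v B‖ = ‖B‖ :=
  NonUnitalStarAlgHom.norm_map (translation v) (translation v).injective B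

end Bounds

end MultiLR

end

theorem mainTheorem1 {d : ℕ} {F : ℝ → ℝ} (hF : MultiLR.IsDecayFunction d F)
    (Ψ : MultiLR.Interaction d) (hΨ : Ψ.eNormW F < ⊤) (V : MultiLR.Potential d) :
    (∀ (t : ℝ) (B : MultiLR.CAR d),
      Filter.Tendsto (fun L : ℝ => MultiLR.finiteDynamics Ψ V L t B) Filter.atTop
        (nhds (MultiLR.dynamics Ψ V t B))) ∧
    ∀ (k : ℕ), 1 ≤ k → ∀ (m : ℕ → ℕ) (s : ℕ → ℝ) (x : ℕ → MultiLR.Site d)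
      (B : ℕ → MultiLR.CAR d),
      (∀ j ≤ k, B j ∈ MultiLR.localAlgebra (MultiLR.box d (m j))) →
      (∀ j, 1 ≤ j → j ≤ k → MultiLR.IsEven (B j)) →
      ‖MultiLR.multiCommutator
          (fun j => if j = 0 then MultiLR.translation (x 0) (B 0)
            else MultiLR.dynamics Ψ V (s j) (MultiLR.translation (x j) (B j))) k‖
        ≤ 2 ^ k * (∏ j ∈ Finset.range (k + 1), ‖B j‖) *
          ∑ T ∈ MultiLR.trees k,
            (MultiLR.overlap k T m x + MultiLR.remainder F k T m s x (Ψ.normW F)) := by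
  refine ⟨MultiLR.tendsto_finiteDynamics hF hΨ V, fun k _ m s x B hB he => ?_⟩
  have hs : Function.update s 0 0 0 = 0 := Function.update_self 0 0 s
  have hs_ne (j : ℕ) (hj : j ≠ 0) : Function.update s 0 0 j = s j := Function.update_of_ne hj 0 s
  have hbound := MultiLR.norm_multiCommutator_dynamics_le hF hΨ V (m := m) (x := x)
    (B := fun j => MultiLR.translation (x j) (B j)) hs
    (fun j hj => MultiLR.translation_mem_localAlgebra (x j) (hB j hj))
    fun j h1 hj => (he j h1 hj).translation (x j)
  have hcommutator (j : ℕ) : MultiLR.dynamics Ψ V (Function.update s 0 0 j)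
        (MultiLR.translation (x j) (B j))
      = if j = 0 then MultiLR.translation (x 0) (B 0)
        else MultiLR.dynamics Ψ V (s j) (MultiLR.translation (x j) (B j)) := by
    split_ifs with hj
    · rw [hj, hs, MultiLR.dynamics_zero]
    · rw [hs_ne j hj]
  have hremainder (T : Finset (Sym2 ℕ)) := MultiLR.remainder_congr (F := F) (α := Ψ.normW F) T m x
    (k := k) fun j h1 _ => hs_ne j (Nat.one_le_iff_ne_zero.mp h1)
  simpa only [hcommutator, hremainder, MultiLR.norm_translation] using hbound
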